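/- Let $G=(V,E)$ be a strongly connected digraph on $n\ge 2$ nodes. For a node $i$ let $d_i$ be the number of its out-neighbours other than $i$, and put $p_{li}=\frac1{1+d_i}$ if $l=i$ or $l$ is an out-neighbour of $i$, and $p_{li}=0$ otherwise. Let the link from $i$ to $j$ have the fixed delay $\tau^{ji}\in\{0,\dots,\bar\tau\}$, with $\tau^{jj}=0$. Let $f_j:\mathbb R\to\mathbb R$ $(j\in V)$ be differentiable, and let $L,\mu>0$ be such that for all $j$ and all $z_1,z_2$ $$|f_j'(z_1)-f_j'(z_2)|\le L|z_1-z_2|,\qquad f_j(z_1)-f_j(z_2)\le f_j'(z_1)(z_1-z_2)-\tfrac{\mu}{2}|z_1-z_2|^2 .$$ *Augmented network.* Put $\bar n=n(\bar\tau+1)$ and let $P^{(r)}$ be the $n\times n$ matrix with entries $P^{(r)}_{ji}=p_{ji}$ if $\tau^{ji}=r$ and $0$ otherwise. Let $\Xi$ be the $\bar n\times\bar n$ matrix of $(\bar\tau+1)\times(\bar\tau+1)$ blocks of size $n\times n$ whose first block column is $P^{(0)},\dots,P^{(\bar\tau)}$, whose blocks just above the block diagonal are identity matrices, and whose other blocks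 are $0$. The coordinates of $\mathbb R^{\bar n}$ are indexed by $(r,j)$, $0\le r\le\bar\tau$, $j\in V$; $(0,j)$ is the actual node $j$, and $(r,j)$ with $r\geq 1$ is a virtual node that holds what will reach $j$ after $r$ more time steps. *R-ADD-OPT.* For a step size $\alpha$ and arbitrary $x_0,z_0\in\mathbb R^n$, start from $\hat x_0=(x_0,0)$, $\hat y_0=(\mathbf 1_n,0)$, $\hat w_0=\nabla\hat f(z_0)$, and iterate $$\hat x_{k+1}=\Xi\hat x_k-\alpha\hat w_k,\quad \hat y_{k+1}=\Xi\hat y_k,\quad z_{k+1}^j=\frac{\hat x_{k+1}^{(0,j)}}{\hat y_{k+1}^{(0,j)}}\ (j\in V),\quad \hat w_{k+1}=\Xi\hat w_k+\nabla\hat f(z_{k+1})-\nabla\hat f(z_k),$$ where $\nabla\hat f(z)\in\mathbb R^{\bar n}$ has the entry $f_j'(z^j)$ at $(0,j)$ and $0$ at virtual nodes. *Constants.* Let $\Xi_\infty=\lim_k\Xi^k$, $\xi=\|\Xi-I\|_2$, $\epsilon=\|I-\Xi_\infty\|_2$, $y=\sup_{k\geq 0}\|\operatorname{diag}(\hat y_k)\|_2$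 and $\tilde y=\sup_{k\ge0}\max_{j\in V}1/\hat y_k^{(0,j)}$. Let $\|\cdot\|$ be a norm on $\mathbb R^{\bar n}$, $0\le\sigma<1$ and $c,d>0$ with $$\|\Xi a-\Xi_\infty a\|\le\sigma\|a-\Xi_\infty a\|,\qquad \|a\|_2\le c\|a\|,\qquad \|a\|\le d\|a\|_2\qquad\text{for all }a\in\mathbb R^{\bar n},$$ and put $\delta=\bar n\mu cd\epsilon L\tilde y(1-\sigma+\xi)$, $\theta=cd\epsilon L^2y\tilde y^2(L+\bar n\mu)$, $$\bar\alpha=\min\left\{\frac{\sqrt{\delta^2+4\bar n\mu(1-\sigma)^2\theta}-\delta}{2\theta},\ \frac1{\bar nL}\right\}.$$ **Theorem.** The limit $\Xi_\infty$ exists, all $\hat y_k^{(0,j)}$ are positive, $y$ and $\tilde y$ are finite, and a norm with constants $\sigma,c,d$ as above exists. The problem $\min_z\frac1n\sum_{j}f_j(z)$ has a unique solution $z^*$. For every such norm and all such $\sigma,c,d$ one has $\bar\alpha>0$, and for every $\alpha\in(0,\bar\alpha)$ the R-ADD-OPT algorithm converges exponentially to $z^*$: there is $\rho\in(0,1)$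 such that for all $x_0,z_0$ there is $C$ with $$|z_k^j-z^*|\le C\rho^k\qquad\text{for all }k\ge0\text{ and all }j\in V.$$ -/

import Mathlib

open Filter Topology

namespace RAddOpt

noncomputable section

/-- A digraph is strongly connected if every node is reachable from every node by a directed walk. -/
def StronglyConnected {V : Type*} (G : Digraph V) : Prop :=
  ∀ i j : V, Relation.ReflTransGen G.Adj i j

section Network

variable {V : Type*} [Fintype V] [DecidableEq V] (G : Digraph V) [DecidableRel G.Adj]

/-- The out-neighbours of `i`, not counting `i` itself (`G.Adj i l` means that `i` sends to `l`). -/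
def outNeighbors (i : V) : Finset V := Finset.univ.filter fun l => l ≠ i ∧ G.Adj i l

/-- The column-stochastic weights: node `i` splits its value evenly among itself and its
out-neighbours, using only the knowledge of its out-degree. -/
def weight : Matrix V V ℝ := Matrix.of fun l i =>
  if l = i ∨ l ∈ outNeighbors G i then 1 / (1 + ((outNeighbors G i).card : ℝ)) else 0

/-- The delays: `τ j i` is the delay of the link from `i` to `j`. A node has its own value without
delay, and the delay of every link is at most `T`. -/
def DelaysBounded (τ : V → V → ℕ) (T : ℕ) : Prop :=
  (∀ j, τ j j = 0) ∧ ∀ i j, i ≠ j → G.Adj i j → τ j i ≤ T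

/-- The nodes of the augmented digraph: `(0, j)` is the actual node `j`, and `(r, j)` with `r ≥ 1` is
the virtual node that holds what will arrive at `j` after `r` further time steps. -/
abbrev AugNode (V : Type*) (T : ℕ) : Type _ := Fin (T + 1) × V

/-- The part of the weight matrix that belongs to the links of delay `r`. -/
def delayedWeight (τ : V → V → ℕ) (r : ℕ) : Matrix V V ℝ := Matrix.of fun j i =>
  if τ j i = r then weight G j i else 0

/-- The augmented matrix `Ξ`: its first block column consists of the matrices `delayedWeight r`,
the blocks just above the block diagonal are identities, and all other blocks vanish. -/
def augMatrix (τ : V → V → ℕ) (T : ℕ) : Matrix (AugNode V T) (AugNode V T) ℝ :=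
  Matrix.of fun p q =>
    if (q.1 : ℕ) = 0 then delayedWeight G τ (p.1 : ℕ) p.2 q.2
    else if (q.1 : ℕ) = (p.1 : ℕ) + 1 ∧ p.2 = q.2 then 1 else 0

/-- The entrywise limit `Ξ_∞` of the powers of `Ξ`. -/
def augLimit (τ : V → V → ℕ) (T : ℕ) : Matrix (AugNode V T) (AugNode V T) ℝ :=
  Matrix.of fun p q => limUnder atTop fun k : ℕ => (augMatrix G τ T ^ k) p q

/-- A vector on the actual nodes, extended by `0` to the virtual nodes. -/
def embed {T : ℕ} (v : V → ℝ) : AugNode V T → ℝ :=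
  fun p => if (p.1 : ℕ) = 0 then v p.2 else 0

/-- The state of the algorithm: `x`, `y`, `w` on the augmented digraph, and `z` on the actual nodes. -/
structure State (V : Type*) (T : ℕ) where
  x : AugNode V T → ℝ
  y : AugNode V T → ℝ
  z : V → ℝ
  w : AugNode V T → ℝ

/-- The R-ADD-OPT iteration with step size `α` for the local functions `f j`, started from arbitrary
`x0`, `z0` on the actual nodes. -/
def iterate (τ : V → V → ℕ) (T : ℕ) (f : V → ℝ → ℝ) (α : ℝ) (x0 z0 : V → ℝ) : ℕ → State V T
  | 0 =>
    { x := embed x0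
      y := embed fun _ => 1
      z := z0
      w := embed fun j => deriv (f j) (z0 j) }
  | k + 1 =>
    let s := iterate τ T f α x0 z0 k
    let x' := (augMatrix G τ T).mulVec s.x - α • s.w
    let y' := (augMatrix G τ T).mulVec s.y
    let z' := fun j : V => x' (0, j) / y' (0, j)
    { x := x'
      y := y'
      z := z'
      w := (augMatrix G τ T).mulVec s.w + (embed fun j => deriv (f j) (z' j))
        - (embed fun j => deriv (f j) (s.z j)) }

/-- The `y`-iterates, which depend on the network only. -/
def yIter (τ : V → V → ℕ) (T : ℕ) (k : ℕ) : AugNode V T → ℝ :=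
  (augMatrix G τ T ^ k).mulVec (embed fun _ => 1)

/-- They are indeed the `y`-component of the iteration. -/
theorem iterate_y (τ : V → V → ℕ) (T : ℕ) (f : V → ℝ → ℝ) (α : ℝ) (x0 z0 : V → ℝ) (k : ℕ) :
    (iterate G τ T f α x0 z0 k).y = yIter G τ T k := by
  induction k with
  | zero => simp [iterate, yIter]
  | succ k ih =>
    simp only [iterate, yIter, ih, Matrix.mulVec_mulVec, pow_succ']

/-- The Euclidean norm of a vector. -/
def norm2 {ι : Type*} [Fintype ι] (a : ι → ℝ) : ℝ := ‖WithLp.toLp 2 a‖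

/-- The spectral norm of a square matrix, i.e. the operator norm for the Euclidean norm. -/
def matNorm2 {ι : Type*} [Fintype ι] [DecidableEq ι] (A : Matrix ι ι ℝ) : ℝ :=
  ‖Matrix.toEuclideanCLM (n := ι) (𝕜 := ℝ) A‖

/-- `ξ = ‖Ξ - I‖₂`. -/
def xi (τ : V → V → ℕ) (T : ℕ) : ℝ := matNorm2 (augMatrix G τ T - 1)

/-- `ε = ‖I - Ξ_∞‖₂`. -/
def eps (τ : V → V → ℕ) (T : ℕ) : ℝ := matNorm2 (1 - augLimit G τ T)

/-- `y = sup_k ‖Y_k‖₂` with `Y_k = diag(y_k)`. -/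
def ySup (τ : V → V → ℕ) (T : ℕ) : ℝ :=
  ⨆ k : ℕ, matNorm2 (Matrix.diagonal (yIter G τ T k))

/-- `ỹ = sup_k ‖Y_k⁻¹‖₂`, where `Y_k` is inverted on the actual nodes: the entries of `y_k` at virtual
nodes may vanish, and their reciprocals are not used by the algorithm. -/
def yInvSup (τ : V → V → ℕ) (T : ℕ) : ℝ :=
  ⨆ k : ℕ, matNorm2 (Matrix.diagonal fun j : V => (yIter G τ T k (0, j))⁻¹)

/-- `Ξ` is a contraction towards `Ξ_∞` with factor `σ < 1` in the vector norm `N`, and `c`, `d` are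
constants of equivalence between `N` and the Euclidean norm. -/
structure IsContractionNorm (τ : V → V → ℕ) (T : ℕ) (N : Seminorm ℝ (AugNode V T → ℝ))
    (σ c d : ℝ) : Prop where
  sigma_nonneg : 0 ≤ σ
  sigma_lt_one : σ < 1
  c_pos : 0 < c
  d_pos : 0 < d
  contraction : ∀ a : AugNode V T → ℝ,
    N ((augMatrix G τ T).mulVec a - (augLimit G τ T).mulVec a)
      ≤ σ * N (a - (augLimit G τ T).mulVec a)
  norm2_le : ∀ a, norm2 a ≤ c * N a
  le_norm2 : ∀ a, N a ≤ d * norm2 a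

/-- The size `n̄ = n (T + 1)` of the augmented digraph. -/
def augSize (V : Type*) [Fintype V] (T : ℕ) : ℝ := (Fintype.card V : ℝ) * ((T : ℝ) + 1)

/-- `δ = n̄ μ c d ε L ỹ (1 - σ + ξ)`. -/
def delta (τ : V → V → ℕ) (T : ℕ) (L μ σ c d : ℝ) : ℝ :=
  augSize V T * μ * c * d * eps G τ T * L * yInvSup G τ T * (1 - σ + xi G τ T)

/-- `θ = c d ε L² y ỹ² (L + n̄ μ)`. -/
def theta (τ : V → V → ℕ) (T : ℕ) (L μ c d : ℝ) : ℝ :=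
  c * d * eps G τ T * L ^ 2 * ySup G τ T * yInvSup G τ T ^ 2 * (L + augSize V T * μ)

/-- The bound `ᾱ` on the step size. -/
def alphaBar (τ : V → V → ℕ) (T : ℕ) (L μ σ c d : ℝ) : ℝ :=
  min ((√(delta G τ T L μ σ c d ^ 2 + 4 * augSize V T * μ * (1 - σ) ^ 2 * theta G τ T L μ c d)
      - delta G τ T L μ σ c d) / (2 * theta G τ T L μ c d))
    (1 / (augSize V T * L))

/-- The assumptions on the local functions: each is differentiable, has an `L`-Lipschitz derivative,
and is `μ`-strongly convex. -/
structure LocalAssumptions (f : V → ℝ → ℝ) (L μ : ℝ) : Prop where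
  L_pos : 0 < L
  mu_pos : 0 < μ
  differentiable : ∀ i, Differentiable ℝ (f i)
  lipschitz : ∀ i z₁ z₂, |deriv (f i) z₁ - deriv (f i) z₂| ≤ L * |z₁ - z₂|
  strongly_convex : ∀ i z₁ z₂,
    f i z₁ - f i z₂ ≤ deriv (f i) z₁ * (z₁ - z₂) - μ / 2 * |z₁ - z₂| ^ 2

/-- The global objective `(1/n) ∑ⱼ fⱼ(z)`. -/
def objective (f : V → ℝ → ℝ) (z : ℝ) : ℝ := 1 / (Fintype.card V : ℝ) * ∑ j, f j z

end Network

end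

end RAddOpt

/-! The matrix `Ξ` is column-stochastic. It need not be irreducible, since a virtual node may
receive nothing, but strong connectivity and the undelayed self-weights give some power of it a
positive row at an actual node. By Doeblin's argument that power contracts the vectors of sum zero
in `ℓ¹`, and a geometrically weighted sum over the lower powers is a norm that `Ξ` itself contracts
(`exists_contracting_seminorm`). Hence `Ξ^k` converges, `Ξ_∞ a` is `(∑ a) / n` times the limit
`yLim` of `y_k` (`augLimit_mulVec`), and `y_k` converges geometrically.

Column sums equal to one keep `∑ w_k` equal to `∑ f_j'(z_k^j)`, so the mean of `x_k` performs
gradient descent with an inexact gradient. Let `e` and `h` be the distances of `x` and `w` from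
their images under `Ξ_∞`, `Φ` the scaled objective gap at the mean, `Q` the scaled mean gradient,
and `r` the error due to `y_k ≠ yLim`. Then `e` is driven by `h`, `h` by the movement of `z`, and
`Φ` decreases like `Q²` up to a gradient error of size `e + r` (`errorStep_iterate`).

Feeding the steady state `e = α h / (1 - σ)`, `Q = s e / κ` back into the tracking error gives a
loop gain. If it is below `1 - σ`, some `h² + b e² + c Φ` contracts (`exists_lyapunov`). The
condition `α < ᾱ` suffices for this: its first bound is a quadratic inequality in `α`, its second
one controls `1/κ` (`small_gain_of_step_size`).

No boundedness of the iterates is known beforehand, so `r` is only small relative to the state: `r²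
≤ C σ^k (1 + Φ + e²)` (`exists_perturbation_sq_le`). Such perturbations do not destroy geometric
decay (`exists_geometric_bound`), and the rate depends only on the contraction factors, not on the
starting point. -/

namespace RAddOpt

/-! ### Euclidean and spectral norms. -/

section Norms

variable {ι : Type*} [Fintype ι]

theorem norm2_nonneg (a : ι → ℝ) : 0 ≤ norm2 a := norm_nonneg _

theorem norm2_add_le (a b : ι → ℝ) : norm2 (a + b) ≤ norm2 a + norm2 b := by
  simpa [norm2] using norm_add_le (WithLp.toLp 2 a) (WithLp.toLp 2 b)

theorem norm2_smul (r : ℝ) (a : ι → ℝ) : norm2 (r • a) = |r| * norm2 a := by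
  simp [norm2, norm_smul]

theorem norm2_sq (a : ι → ℝ) : norm2 a ^ 2 = ∑ i, a i ^ 2 := by
  simp [norm2, EuclideanSpace.norm_sq_eq]

theorem norm2_le_norm2 {κ : Type*} [Fintype κ] {a : ι → ℝ} {b : κ → ℝ}
    (h : ∑ i, a i ^ 2 ≤ ∑ j, b j ^ 2) : norm2 a ≤ norm2 b := by
  rw [← norm2_sq, ← norm2_sq] at h
  exact (sq_le_sq₀ (norm2_nonneg _) (norm2_nonneg _)).1 h

theorem norm2_le_mul_norm2 {a b : ι → ℝ} {C : ℝ} (hC : 0 ≤ C) (h : ∀ i, |a i| ≤ C * |b i|) :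
    norm2 a ≤ C * norm2 b := by
  rw [← abs_of_nonneg hC, ← norm2_smul]
  refine norm2_le_norm2 (Finset.sum_le_sum fun i _ => ?_)
  rw [sq_le_sq, Pi.smul_apply, smul_eq_mul, abs_mul, abs_of_nonneg hC]
  exact h i

theorem abs_le_norm2 (a : ι → ℝ) (i : ι) : |a i| ≤ norm2 a := by
  have := PiLp.norm_apply_le (WithLp.toLp 2 a) i
  simpa [norm2] using this

theorem norm2_le_sum_abs (a : ι → ℝ) : norm2 a ≤ ∑ i, |a i| := by
  refine (sq_le_sq₀ (norm2_nonneg _) (Finset.sum_nonneg fun i _ => abs_nonneg _)).1 ?_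
  rw [norm2_sq]
  calc ∑ i, a i ^ 2 = ∑ i, |a i| ^ 2 := by simp
    _ ≤ (∑ i, |a i|) ^ 2 := Finset.sum_sq_le_sq_sum_of_nonneg fun i _ => abs_nonneg _

theorem sum_abs_le_card_mul_norm2 (a : ι → ℝ) : ∑ i, |a i| ≤ Fintype.card ι * norm2 a := by
  calc ∑ i, |a i| ≤ ∑ _i : ι, norm2 a := Finset.sum_le_sum fun i _ => abs_le_norm2 a i
    _ = Fintype.card ι * norm2 a := by simp

theorem sum_abs_le_sqrt_card_mul_norm2 (a : ι → ℝ) :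
    ∑ i, |a i| ≤ √(Fintype.card ι) * norm2 a := by
  refine abs_le_of_sq_le_sq' ?_ (mul_nonneg (Real.sqrt_nonneg _) (norm2_nonneg _)) |>.2
  rw [mul_pow, Real.sq_sqrt (Nat.cast_nonneg _), norm2_sq]
  simpa using sq_sum_le_card_mul_sum_sq (s := Finset.univ) (f := fun i => |a i|)

theorem norm2_const (r : ℝ) : norm2 (fun _ : ι => r) = √(Fintype.card ι) * |r| := by
  rw [← Real.sqrt_sq (norm2_nonneg _), norm2_sq]
  simp [Real.sqrt_sq_eq_abs]

variable [DecidableEq ι]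

theorem norm2_mulVec_le (A : Matrix ι ι ℝ) (a : ι → ℝ) :
    norm2 (A.mulVec a) ≤ matNorm2 A * norm2 a := by
  have := (Matrix.toEuclideanCLM (n := ι) (𝕜 := ℝ) A).le_opNorm (WithLp.toLp 2 a)
  rwa [Matrix.toEuclideanCLM_toLp] at this

theorem matNorm2_nonneg (A : Matrix ι ι ℝ) : 0 ≤ matNorm2 A := norm_nonneg _

theorem matNorm2_pos {A : Matrix ι ι ℝ} (hA : A ≠ 0) : 0 < matNorm2 A :=
  norm_pos_iff.2 fun h => hA (by simpa using h)

theorem matNorm2_diagonal (v : ι → ℝ) : matNorm2 (Matrix.diagonal v) = ‖v‖ :=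
  Matrix.l2_opNorm_diagonal v

end Norms

/-! ### Column-stochastic matrices with a positive row in some power. -/

section Stochastic

open Matrix

variable {ι : Type*} [Fintype ι] [DecidableEq ι] {M : Matrix ι ι ℝ}

theorem sum_abs_mulVec_le (hM : M ∈ colStochastic ℝ ι) (a : ι → ℝ) :
    ∑ i, |(M *ᵥ a) i| ≤ ∑ i, |a i| := by
  calc ∑ i, |(M *ᵥ a) i| ≤ ∑ i, ∑ j, M i j * |a j| := by
        refine Finset.sum_le_sum fun i _ => (Finset.abs_sum_le_sum_abs _ _).trans_eq ?_
        simp [abs_mul, abs_of_nonneg (hM.1 i _)]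
    _ = ∑ j, |a j| := by
        rw [Finset.sum_comm]
        simp [← Finset.sum_mul, sum_col_of_mem_colStochastic hM]

/-- A column-stochastic matrix with a row that is bounded below by `β` contracts the vectors of sum
zero by the factor `1 - β` in the `ℓ¹` norm. -/
theorem sum_abs_mulVec_le_of_row (hM : M ∈ colStochastic ℝ ι) {i₀ : ι} {β : ℝ}
    (hβ : ∀ j, β ≤ M i₀ j) {a : ι → ℝ} (ha : ∑ i, a i = 0) :
    ∑ i, |(M *ᵥ a) i| ≤ (1 - β) * ∑ i, |a i| := by
  -- As `a` sums to zero, `β` can be subtracted from the whole row `i₀` without changing `M *ᵥ a`;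
  -- the entries stay nonnegative and every column now sums to `1 - β`.
  have key : ∀ i, (M *ᵥ a) i = ∑ j, (M i j - if i = i₀ then β else 0) * a j := by
    intro i
    simp [sub_mul, ← Finset.mul_sum, ha, mulVec, dotProduct]
  calc ∑ i, |(M *ᵥ a) i| ≤ ∑ i, ∑ j, (M i j - if i = i₀ then β else 0) * |a j| := by
        refine Finset.sum_le_sum fun i _ => ?_
        rw [key]
        refine (Finset.abs_sum_le_sum_abs _ _).trans_eq (Finset.sum_congr rfl fun j _ => ?_)
        rw [abs_mul, abs_of_nonneg]
        split_ifs with h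
        · rw [h]; linarith [hβ j]
        · simpa using hM.1 i j
    _ = ∑ j, (1 - β) * |a j| := by
        rw [Finset.sum_comm]
        refine Finset.sum_congr rfl fun j _ => ?_
        rw [← Finset.sum_mul, Finset.sum_sub_distrib, sum_col_of_mem_colStochastic hM]
        simp
    _ = (1 - β) * ∑ i, |a i| := by rw [Finset.mul_sum]

/-- The seminorm `∑_{i < m} g⁻ⁱ ‖Mⁱ a‖₁`. -/
noncomputable def powSeminorm (M : Matrix ι ι ℝ) (m : ℕ) (g : ℝ) (hg : 0 < g) :
    Seminorm ℝ (ι → ℝ) :=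
  Seminorm.of (fun a => ∑ i ∈ Finset.range m, (g ^ i)⁻¹ * ∑ p, |((M ^ i) *ᵥ a) p|)
    (fun a b => by
      rw [← Finset.sum_add_distrib]
      refine Finset.sum_le_sum fun i _ => ?_
      rw [← mul_add, ← Finset.sum_add_distrib, mulVec_add]
      gcongr
      exact abs_add_le _ _)
    (fun r a => by
      simp only [mulVec_smul, Pi.smul_apply, smul_eq_mul, abs_mul, Finset.mul_sum, Real.norm_eq_abs]
      refine Finset.sum_congr rfl fun i _ => Finset.sum_congr rfl fun p _ => ?_
      ring)

theorem powSeminorm_apply (M : Matrix ι ι ℝ) (m : ℕ) {g : ℝ} (hg : 0 < g) (a : ι → ℝ) :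
    powSeminorm M m g hg a = ∑ i ∈ Finset.range m, (g ^ i)⁻¹ * ∑ p, |((M ^ i) *ᵥ a) p| := rfl

/-- If some power of a column-stochastic matrix has a positive row, then there is a norm in which
the matrix contracts the vectors of sum zero. -/
theorem exists_contracting_seminorm (hM : M ∈ colStochastic ℝ ι) {m : ℕ} (hm : 0 < m) {i₀ : ι}
    (hpos : ∀ j, 0 < (M ^ m) i₀ j) :
    ∃ (N : Seminorm ℝ (ι → ℝ)) (σ c d : ℝ), 0 ≤ σ ∧ σ < 1 ∧ 0 < c ∧ 0 < d ∧
      (∀ a : ι → ℝ, ∑ i, a i = 0 → N (M *ᵥ a) ≤ σ * N a) ∧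
      (∀ a, norm2 a ≤ c * N a) ∧ ∀ a, N a ≤ d * norm2 a := by
  have : Nonempty ι := ⟨i₀⟩
  obtain ⟨j₀, hj₀⟩ := Finite.exists_min fun j => (M ^ m) i₀ j
  obtain ⟨β, hβ0, hβ1, hβ⟩ : ∃ β : ℝ, 0 < β ∧ β < 1 ∧ ∀ j, β ≤ (M ^ m) i₀ j :=
    -- The cap `1 / 2` keeps `1 - β` positive, so that its `m`-th root `g` is a positive contraction
    -- factor.
    ⟨min ((M ^ m) i₀ j₀) (1 / 2), lt_min (hpos _) (by norm_num),
      (min_le_right _ _).trans_lt (by norm_num), fun j => (min_le_left _ _).trans (hj₀ j)⟩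
  obtain ⟨g, hg0, hg1, hgm⟩ : ∃ g : ℝ, 0 < g ∧ g < 1 ∧ g ^ m = 1 - β := by
    refine ⟨(1 - β) ^ (m⁻¹ : ℝ), Real.rpow_pos_of_pos (by linarith) _,
      Real.rpow_lt_one (by linarith) (by linarith) (by positivity), ?_⟩
    exact Real.rpow_inv_natCast_pow (by linarith) hm.ne'
  refine ⟨powSeminorm M m g hg0, g, 1, (∑ i ∈ Finset.range m, (g ^ i)⁻¹) * Fintype.card ι,
    hg0.le, hg1, one_pos, ?_, fun a ha => ?_, fun a => ?_, fun a => ?_⟩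
  · have : 0 < ∑ i ∈ Finset.range m, (g ^ i)⁻¹ :=
      Finset.sum_pos (fun i _ => by positivity) (Finset.nonempty_range_iff.2 hm.ne')
    positivity
  · rw [powSeminorm_apply, powSeminorm_apply]
    set v : ℕ → ℝ := fun i => (g ^ i)⁻¹ * ∑ p, |((M ^ i) *ᵥ a) p| with hv
    -- Applying `M` shifts the sum by one index and produces a factor `g`. The new last term `v m`
    -- is paid for by the lost first term `v 0`, because `M ^ m` contracts by `1 - β = g ^ m`.
    have h1 : ∀ i, (g ^ i)⁻¹ * ∑ p, |((M ^ i) *ᵥ (M *ᵥ a)) p| = g * v (i + 1) := by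
      intro i
      rw [mulVec_mulVec, ← pow_succ]
      simp only [hv]
      field_simp
      ring
    have h2 : v m ≤ v 0 := by
      have := sum_abs_mulVec_le_of_row (pow_mem hM m) hβ ha
      simp only [hv, pow_zero, one_mulVec, inv_one, one_mul, hgm]
      rwa [inv_mul_le_iff₀ (by linarith)]
    simp only [h1]
    rw [← Finset.mul_sum]
    have h3 := Finset.sum_range_succ v m
    have h4 := Finset.sum_range_succ' v m
    exact mul_le_mul_of_nonneg_left (by linarith) hg0.le
  · rw [one_mul, powSeminorm_apply]
    refine (norm2_le_sum_abs a).trans ?_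
    have := Finset.single_le_sum (f := fun i => (g ^ i)⁻¹ * ∑ p, |((M ^ i) *ᵥ a) p|)
      (fun i _ => by positivity) (Finset.mem_range.2 hm)
    simpa using this
  · rw [powSeminorm_apply, mul_assoc, Finset.sum_mul]
    refine Finset.sum_le_sum fun i _ => ?_
    gcongr
    exact (sum_abs_mulVec_le (pow_mem hM i) a).trans (sum_abs_le_card_mul_norm2 a)

theorem seminorm_pow_mulVec_le (hM : M ∈ colStochastic ℝ ι) {N : Seminorm ℝ (ι → ℝ)} {σ : ℝ}
    (hσ : 0 ≤ σ) (hN : ∀ a : ι → ℝ, ∑ i, a i = 0 → N (M *ᵥ a) ≤ σ * N a) {a : ι → ℝ}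
    (ha : ∑ i, a i = 0) (k : ℕ) : N ((M ^ k) *ᵥ a) ≤ σ ^ k * N a := by
  induction k with
  | zero => simp
  | succ k ih =>
    have h0 : ∑ i, ((M ^ k) *ᵥ a) i = 0 := by
      rw [sum_mulVec_of_mem_colStochastic (pow_mem hM k), ha]
    rw [pow_succ', ← mulVec_mulVec]
    calc N (M *ᵥ ((M ^ k) *ᵥ a)) ≤ σ * N ((M ^ k) *ᵥ a) := hN _ h0
      _ ≤ σ * (σ ^ k * N a) := by gcongr
      _ = σ ^ (k + 1) * N a := by ring

/-- The powers of a column-stochastic matrix with a positive row in some power converge. -/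
theorem exists_tendsto_pow (hM : M ∈ colStochastic ℝ ι) {m : ℕ} (hm : 0 < m) {i₀ : ι}
    (hpos : ∀ j, 0 < (M ^ m) i₀ j) (p q : ι) :
    ∃ l, Tendsto (fun k : ℕ => (M ^ k) p q) atTop (𝓝 l) := by
  obtain ⟨N, σ, c, d, hσ0, hσ1, hc, -, hN, hNc, -⟩ := exists_contracting_seminorm hM hm hpos
  set a : ι → ℝ := Pi.single q 1 - M *ᵥ Pi.single q 1 with ha
  have ha0 : ∑ i, a i = 0 := by
    simp only [ha, Pi.sub_apply, Finset.sum_sub_distrib, sum_mulVec_of_mem_colStochastic hM, sub_self]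
  refine cauchySeq_tendsto_of_complete
    (cauchySeq_of_le_geometric σ (c * N a) hσ1 fun k => ?_)
  -- Successive differences of column `q` are `M ^ k` applied to a fixed vector of sum zero, hence
  -- geometrically small.
  have h1 : (M ^ k) p q - (M ^ (k + 1)) p q = ((M ^ k) *ᵥ a) p := by
    rw [ha, mulVec_sub, mulVec_mulVec, ← pow_succ]
    simp
  rw [Real.dist_eq, h1]
  calc |((M ^ k) *ᵥ a) p| ≤ norm2 ((M ^ k) *ᵥ a) := abs_le_norm2 _ _
    _ ≤ c * N ((M ^ k) *ᵥ a) := hNc _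
    _ ≤ c * (σ ^ k * N a) := by gcongr; exact seminorm_pow_mulVec_le hM hσ0 hN ha0 k
    _ = c * N a * σ ^ k := by ring

variable {J : Matrix ι ι ℝ}

theorem limit_mem_colStochastic (hM : M ∈ colStochastic ℝ ι)
    (hJ : Tendsto (fun k : ℕ => M ^ k) atTop (𝓝 J)) : J ∈ colStochastic ℝ ι := by
  replace hJ := fun i j => ((continuous_id.matrix_elem i j).tendsto J).comp hJ
  rw [mem_colStochastic_iff_sum]
  refine ⟨fun i j => ge_of_tendsto' (hJ i j) fun k => (pow_mem hM k).1 i j, fun j => ?_⟩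
  refine tendsto_nhds_unique (tendsto_finsetSum _ fun i _ => hJ i j) ?_
  simp [sum_col_of_mem_colStochastic (pow_mem hM _)]

theorem mul_limit_eq (hJ : Tendsto (fun k : ℕ => M ^ k) atTop (𝓝 J)) : M * J = J := by
  refine tendsto_nhds_unique (hJ.const_mul M) ?_
  simpa only [← pow_succ', Function.comp_def] using hJ.comp (tendsto_add_atTop_nat 1)

theorem limit_mul_eq (hJ : Tendsto (fun k : ℕ => M ^ k) atTop (𝓝 J)) : J * M = J := by
  refine tendsto_nhds_unique (hJ.mul_const M) ?_
  simpa only [← pow_succ, Function.comp_def] using hJ.comp (tendsto_add_atTop_nat 1)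

theorem tendsto_pow_mulVec (hJ : Tendsto (fun k : ℕ => M ^ k) atTop (𝓝 J)) (a : ι → ℝ) :
    Tendsto (fun k : ℕ => (M ^ k) *ᵥ a) atTop (𝓝 (J *ᵥ a)) :=
  ((continuous_id.matrix_mulVec continuous_const).tendsto J).comp hJ

/-- The limit of the powers annihilates the vectors of sum zero. -/
theorem limit_mulVec_eq_zero (hM : M ∈ colStochastic ℝ ι) {m : ℕ} (hm : 0 < m) {i₀ : ι}
    (hpos : ∀ j, 0 < (M ^ m) i₀ j) (hJ : Tendsto (fun k : ℕ => M ^ k) atTop (𝓝 J))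
    {a : ι → ℝ} (ha : ∑ i, a i = 0) : J *ᵥ a = 0 := by
  obtain ⟨N, σ, c, d, hσ0, hσ1, hc, -, hN, hNc, -⟩ := exists_contracting_seminorm hM hm hpos
  ext p
  refine tendsto_nhds_unique (tendsto_pi_nhds.1 (tendsto_pow_mulVec hJ a) p) ?_
  have hlim : Tendsto (fun k : ℕ => c * (σ ^ k * N a)) atTop (𝓝 0) := by
    simpa using ((tendsto_pow_atTop_nhds_zero_of_lt_one hσ0 hσ1).mul_const (N a)).const_mul c
  refine squeeze_zero_norm (fun k => ?_) hlim
  calc |((M ^ k) *ᵥ a) p| ≤ norm2 ((M ^ k) *ᵥ a) := abs_le_norm2 _ _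
    _ ≤ c * N ((M ^ k) *ᵥ a) := hNc _
    _ ≤ c * (σ ^ k * N a) := by gcongr; exact seminorm_pow_mulVec_le hM hσ0 hN ha k

end Stochastic

/-! ### Geometric decay and the Lyapunov function of the error dynamics. -/

/-- A nonnegative sequence that contracts by the factor `1 - η`, up to geometrically vanishing
relative and absolute perturbations, decays geometrically; the rate depends on `η` and `γ` only. -/
theorem exists_geometric_bound {η γ ρ C : ℝ} (hη1 : η ≤ 1) (hγ0 : 0 ≤ γ) (hρ0 : 0 < ρ)
    (hηρ : 1 - η < ρ) (hγρ : γ ≤ ρ) (hρ1 : ρ < 1) (hC : 0 ≤ C) {W : ℕ → ℝ}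
    (hW : ∀ k, 0 ≤ W k) (h : ∀ k, W (k + 1) ≤ (1 - η) * W k + C * γ ^ k * (1 + W k)) :
    ∃ C', 0 ≤ C' ∧ ∀ k, W k ≤ C' * ρ ^ k := by
  have hgap : 0 < ρ - (1 - η) := by linarith
  have hlim : Tendsto (fun k : ℕ => C * γ ^ k) atTop (𝓝 0) := by
    simpa using (tendsto_pow_atTop_nhds_zero_of_lt_one hγ0 (hγρ.trans_lt hρ1)).const_mul C
  -- After `k₀` the relative perturbation takes at most half of the gap `ρ - (1 - η)`. `D` covers
  -- the indices up to `k₀`, and `E` is such that the absolute perturbation fits into the other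
  -- half.
  obtain ⟨k₀, hk₀⟩ := (hlim.eventually (ge_mem_nhds (half_pos hgap))).exists_forall_of_atTop
  set D : ℝ := ∑ i ∈ Finset.range (k₀ + 1), W i / ρ ^ i
  have hD : 0 ≤ D := Finset.sum_nonneg fun i _ => div_nonneg (hW i) (by positivity)
  set E : ℝ := 2 * C / (ρ - (1 - η))
  have hE : 0 ≤ E := by positivity
  have hEC : C = E * ((ρ - (1 - η)) / 2) := by simp only [E]; field_simp
  have hinit : ∀ k ≤ k₀, W k ≤ (D + E) * ρ ^ k := by
    intro k hk
    have : W k / ρ ^ k ≤ D :=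
      Finset.single_le_sum (f := fun i => W i / ρ ^ i)
        (fun i _ => div_nonneg (hW i) (by positivity)) (Finset.mem_range.2 (by omega))
    rw [← div_le_iff₀ (by positivity)]
    linarith
  refine ⟨D + E, by positivity, fun k => ?_⟩
  induction k with
  | zero => exact hinit 0 (Nat.zero_le _)
  | succ k ih =>
    rcases lt_or_ge k k₀ with hk | hk
    · exact hinit _ hk
    · have h1 := h k
      have h2 : C * γ ^ k ≤ (ρ - (1 - η)) / 2 := hk₀ k hk
      have h3 : C * γ ^ k ≤ C * ρ ^ k := by gcongr
      have h4 : C * γ ^ k * W k ≤ (ρ - (1 - η)) / 2 * W k :=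
        mul_le_mul_of_nonneg_right h2 (hW k)
      have h5 : C * ρ ^ k ≤ (D + E) * ((ρ - (1 - η)) / 2) * ρ ^ k := by
        gcongr
        rw [hEC]
        gcongr
        linarith
      have h6 := mul_le_mul_of_nonneg_left ih (by linarith : 0 ≤ 1 - η + (ρ - (1 - η)) / 2)
      calc W (k + 1) ≤ (1 - η + (ρ - (1 - η)) / 2) * W k + C * ρ ^ k := by linarith
        _ ≤ (1 - η + (ρ - (1 - η)) / 2) * ((D + E) * ρ ^ k)
            + (D + E) * ((ρ - (1 - η)) / 2) * ρ ^ k := by linarith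
        _ = (D + E) * ρ ^ (k + 1) := by ring

/-- A weighted Cauchy-Schwarz inequality for four terms. -/
theorem sq_sum_four_le {w₁ w₂ w₃ w₄ : ℝ} (h₁ : 0 ≤ w₁) (h₂ : 0 ≤ w₂) (h₃ : 0 ≤ w₃) (h₄ : 0 ≤ w₄)
    (t₁ t₂ t₃ t₄ : ℝ) :
    (w₁ * t₁ + w₂ * t₂ + w₃ * t₃ + w₄ * t₄) ^ 2 ≤ (w₁ + w₂ + w₃ + w₄)
      * (w₁ * t₁ ^ 2 + w₂ * t₂ ^ 2 + w₃ * t₃ ^ 2 + w₄ * t₄ ^ 2) := by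
  have h₁₂ := mul_nonneg (mul_nonneg h₁ h₂) (sq_nonneg (t₁ - t₂))
  have h₁₃ := mul_nonneg (mul_nonneg h₁ h₃) (sq_nonneg (t₁ - t₃))
  have h₁₄ := mul_nonneg (mul_nonneg h₁ h₄) (sq_nonneg (t₁ - t₄))
  have h₂₃ := mul_nonneg (mul_nonneg h₂ h₃) (sq_nonneg (t₂ - t₃))
  have h₂₄ := mul_nonneg (mul_nonneg h₂ h₄) (sq_nonneg (t₂ - t₄))
  have h₃₄ := mul_nonneg (mul_nonneg h₃ h₄) (sq_nonneg (t₃ - t₄))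
  linarith

/-- Convexity of the square: a contraction with an input squares to a contraction with an input. -/
theorem sq_contraction_add_le {σ : ℝ} (h0 : 0 ≤ σ) (h1 : σ < 1) (a b : ℝ) :
    (σ * a + b) ^ 2 ≤ σ * a ^ 2 + b ^ 2 / (1 - σ) := by
  have h2 : 0 < 1 - σ := by linarith
  have : σ * a ^ 2 + b ^ 2 / (1 - σ) - (σ * a + b) ^ 2
      = σ / (1 - σ) * ((1 - σ) * a - b) ^ 2 := by
    field_simp
    ring
  have : 0 ≤ σ / (1 - σ) * ((1 - σ) * a - b) ^ 2 := by positivity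
  linarith

/-- One step of the error dynamics of gradient tracking: `e` is the consensus error, `h` the
tracking error, `Φ` the gap in the objective, `Q` the size of the mean gradient and `r` a
perturbation. -/
structure ErrorStep (σ α κ A B ℓ s M e h Q Φ r e' h' Φ' : ℝ) : Prop where
  e_nonneg : 0 ≤ e
  h_nonneg : 0 ≤ h
  Q_nonneg : 0 ≤ Q
  gap_nonneg : 0 ≤ Φ
  r_nonneg : 0 ≤ r
  e'_nonneg : 0 ≤ e'
  h'_nonneg : 0 ≤ h'
  consensus : e' ≤ σ * e + α * h
  tracking : h' ≤ σ * h + ℓ * (A * e + B * h + α * Q + r)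
  descent : Φ' ≤ Φ - α * κ * Q ^ 2 + α * Q * (s * e + r)
  gap_le : Φ ≤ M * (Q + s * e + r) ^ 2

set_option maxHeartbeats 1000000 in
/-- Under a small-gain condition the error dynamics has a quadratic Lyapunov function. -/
theorem exists_lyapunov {σ α κ A B ℓ s M : ℝ} (hσ0 : 0 ≤ σ) (hσ1 : σ < 1) (hα : 0 < α)
    (hκ : 0 < κ) (hA : 0 ≤ A) (hB : 0 ≤ B) (hℓ : 0 < ℓ) (hs : 0 < s) (hM : 0 < M)
    (hgain : ℓ * (A * (α / (1 - σ)) + B + α * (s * (α / (1 - σ)) / κ)) < 1 - σ) :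
    ∃ b c η C : ℝ, 0 < b ∧ 0 < c ∧ 0 < η ∧ η ≤ 1 ∧ 0 ≤ C ∧ ∀ e h Q Φ r e' h' Φ' : ℝ,
      ErrorStep σ α κ A B ℓ s M e h Q Φ r e' h' Φ' →
        h' ^ 2 + b * e' ^ 2 + c * Φ' ≤ (1 - η) * (h ^ 2 + b * e ^ 2 + c * Φ) + C * r ^ 2 := by
  obtain ⟨lam, hlam⟩ : ∃ lam, lam = 1 - σ := ⟨_, rfl⟩
  have hlam0 : 0 < lam := by linarith
  rw [← hlam] at hgain
  -- `p` and `q` are the steady-state ratios `e / h` and `Q / h`; `D` is then the total feedback to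
  -- `h`, and `t` is the slack of the small-gain condition, used as the weight of `r`.
  obtain ⟨p, hp⟩ : ∃ p, p = α / lam := ⟨_, rfl⟩
  have hp0 : 0 < p := by rw [hp]; positivity
  have hαp : α = p * lam := by rw [hp]; field_simp
  rw [← hp] at hgain
  obtain ⟨q, hq⟩ : ∃ q, q = s * p / κ := ⟨_, rfl⟩
  have hq0 : 0 < q := by rw [hq]; positivity
  have hsq : s = q * κ / p := by rw [hq]; field_simp
  rw [← hq] at hgain
  set D := A * p + B + α * q with hD
  have hD0 : 0 < D := by positivity
  obtain ⟨t, ht0, ht⟩ : ∃ t, 0 < t ∧ ℓ * (D + t) < lam := by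
    refine ⟨(lam / ℓ - D) / 2, half_pos (sub_pos.2 ((lt_div_iff₀' hℓ).2 hgain)), ?_⟩
    have : ℓ * (D + (lam / ℓ - D) / 2) = (ℓ * D + lam) / 2 := by field_simp; ring
    rw [this]
    linarith
  obtain ⟨g, hg⟩ : ∃ g, g = ℓ ^ 2 * (D + t) / lam := ⟨_, rfl⟩
  have hg0 : 0 < g := by rw [hg]; positivity
  obtain ⟨m, hm⟩ : ∃ m, m = lam - g * D := ⟨_, rfl⟩
  have hm0 : 0 < m := by
    have h1 : g * (D + t) < lam := by
      rw [hg, div_mul_eq_mul_div, div_lt_iff₀ hlam0]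
      have : 0 < ℓ * (D + t) := by positivity
      nlinarith
    have h2 : 0 < g * t := by positivity
    rw [hm]
    linarith
  -- Here `m` is the decay of `h²` that remains after the feedback. The surplus `n` given below to
  -- the decay of `e²` and `Q²` costs at most `n * R` in the coefficient of `h²`, so at least `m /
  -- 2` survives.
  obtain ⟨R, hR⟩ : ∃ R, R = g * α * q + 2 * α * q ^ 2 + p ^ 2 := ⟨_, rfl⟩
  have hR0 : 0 < R := by rw [hR]; positivity
  obtain ⟨n, hn0, hn1, hnR⟩ : ∃ n, 0 < n ∧ n ≤ 1 ∧ n * R ≤ m / 2 := by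
    refine ⟨min 1 (m / 2 / R), by positivity, min_le_left _ _, ?_⟩
    rw [← le_div_iff₀ hR0]
    exact min_le_right _ _
  -- `c` makes the descent term `c α κ / 2 * Q²` cancel the `Q²` of the tracking bound with surplus
  -- `α n`; `b` makes `b * lam` cancel all `e²` terms with surplus `n`.
  obtain ⟨c, hc⟩ : ∃ c, c = 2 / κ * (g / q + n) := ⟨_, rfl⟩
  have hc0 : 0 < c := by rw [hc]; positivity
  obtain ⟨b, hb⟩ : ∃ b, b = (g * A / p + (1 + n) * α * (q ^ 2 / p ^ 2) * (g / q + n) + n) / lam :=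
    ⟨_, rfl⟩
  have hb0 : 0 < b := by rw [hb]; positivity
  -- The part `z` of the surplus in `Q²` is turned into decay of `Φ` by the bound `gap_le`, at the
  -- expense of half of the surplus in `e²`.
  obtain ⟨z, hz0, hz1, hz2⟩ : ∃ z, 0 < z ∧ z ≤ α * n ∧ z * s ^ 2 ≤ n / 2 := by
    refine ⟨min (α * n) (n / 2 / s ^ 2), by positivity, min_le_left _ _, ?_⟩
    rw [← le_div_iff₀ (by positivity)]
    exact min_le_right _ _
  obtain ⟨η, hη0, hη1, hηm, hηb, hηc⟩ :
      ∃ η, 0 < η ∧ η ≤ 1 ∧ η ≤ m / 2 ∧ η * b ≤ n / 2 ∧ η * c ≤ z / (3 * M) := by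
    refine ⟨min (min 1 (m / 2)) (min (n / 2 / b) (z / (3 * M) / c)), by positivity,
      (min_le_left _ _).trans (min_le_left _ _), (min_le_left _ _).trans (min_le_right _ _), ?_, ?_⟩
    · rw [← le_div_iff₀ hb0]
      exact (min_le_right _ _).trans (min_le_left _ _)
    · rw [← le_div_iff₀ hc0]
      exact (min_le_right _ _).trans (min_le_right _ _)
  obtain ⟨C₁, hC₁⟩ : ∃ C₁, C₁ = g / t + c * α * (1 + 1 / n) / (2 * κ) := ⟨_, rfl⟩
  have hC₁0 : 0 < C₁ := by rw [hC₁]; positivity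
  refine ⟨b, c, η, C₁ + z, hb0, hc0, hη0, hη1, by positivity, ?_⟩
  intro e h Q Φ r e' h' Φ' H
  have htrack : h' ^ 2 ≤ σ * h ^ 2
      + g * (A / p * e ^ 2 + B * h ^ 2 + α / q * Q ^ 2 + r ^ 2 / t) := by
    have h1 := sq_contraction_add_le hσ0 hσ1 h (ℓ * (A * e + B * h + α * Q + r))
    -- The terms are normalized by their steady-state ratios, where Cauchy-Schwarz is sharp; this is
    -- why the small-gain condition suffices.
    have h2 := sq_sum_four_le (by positivity : 0 ≤ A * p) hB (by positivity : 0 ≤ α * q) ht0.le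
      (e / p) h (Q / q) (r / t)
    have h3 : A * p * (e / p) + B * h + α * q * (Q / q) + t * (r / t)
        = A * e + B * h + α * Q + r := by field_simp
    have h4 : A * p * (e / p) ^ 2 + B * h ^ 2 + α * q * (Q / q) ^ 2 + t * (r / t) ^ 2
        = A / p * e ^ 2 + B * h ^ 2 + α / q * Q ^ 2 + r ^ 2 / t := by field_simp
    rw [h3, h4] at h2
    have h5 : (ℓ * (A * e + B * h + α * Q + r)) ^ 2 / (1 - σ)
        ≤ g * (A / p * e ^ 2 + B * h ^ 2 + α / q * Q ^ 2 + r ^ 2 / t) := by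
      rw [← hlam, hg, div_mul_eq_mul_div, mul_pow, mul_assoc (ℓ ^ 2)]
      gcongr
    have h6 : h' ^ 2 ≤ (σ * h + ℓ * (A * e + B * h + α * Q + r)) ^ 2 :=
      pow_le_pow_left₀ H.h'_nonneg H.tracking 2
    linarith
  have hcons : e' ^ 2 ≤ σ * e ^ 2 + p ^ 2 * lam * h ^ 2 := by
    have h1 := sq_contraction_add_le hσ0 hσ1 e (α * h)
    have h2 : (α * h) ^ 2 / (1 - σ) = p ^ 2 * lam * h ^ 2 := by
      rw [← hlam, hαp]; field_simp
    have h3 : e' ^ 2 ≤ (σ * e + α * h) ^ 2 := pow_le_pow_left₀ H.e'_nonneg H.consensus 2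
    linarith
  have hdesc : c * Φ' ≤ c * Φ - α * (g / q + n) * Q ^ 2
      + (1 + n) * α * (q ^ 2 / p ^ 2) * (g / q + n) * e ^ 2
      + c * α * (1 + 1 / n) / (2 * κ) * r ^ 2 := by
    have h1 : Q * (s * e + r) ≤ κ / 2 * Q ^ 2 + (s * e + r) ^ 2 / (2 * κ) := by
      have : κ / 2 * Q ^ 2 + (s * e + r) ^ 2 / (2 * κ) - Q * (s * e + r)
          = (κ * Q - (s * e + r)) ^ 2 / (2 * κ) := by field_simp; ring
      have : 0 ≤ (κ * Q - (s * e + r)) ^ 2 / (2 * κ) := by positivity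
      linarith
    have h2 : (s * e + r) ^ 2 ≤ (1 + n) * s ^ 2 * e ^ 2 + (1 + 1 / n) * r ^ 2 := by
      have : (1 + n) * s ^ 2 * e ^ 2 + (1 + 1 / n) * r ^ 2 - (s * e + r) ^ 2
          = (n * s * e - r) ^ 2 / n := by field_simp; ring
      have : 0 ≤ (n * s * e - r) ^ 2 / n := by positivity
      linarith
    have h3 : (s * e + r) ^ 2 / (2 * κ)
        ≤ ((1 + n) * s ^ 2 * e ^ 2 + (1 + 1 / n) * r ^ 2) / (2 * κ) := by gcongr
    have h4 : c * Φ' ≤ c * (Φ - α * κ * Q ^ 2 + α * (κ / 2 * Q ^ 2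
        + ((1 + n) * s ^ 2 * e ^ 2 + (1 + 1 / n) * r ^ 2) / (2 * κ))) := by
      apply mul_le_mul_of_nonneg_left _ hc0.le
      have h5 := mul_le_mul_of_nonneg_left (h1.trans (add_le_add_right h3 _)) hα.le
      have h6 := H.descent
      linarith
    refine h4.trans (le_of_eq ?_)
    have h7 : α * (g / q + n) = c * α * κ / 2 := by rw [hc]; field_simp
    have h8 : (1 + n) * α * (q ^ 2 / p ^ 2) * (g / q + n) = c * α * (1 + n) * s ^ 2 / (2 * κ) := by
      rw [hc, hsq]; field_simp
    rw [h7, h8]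
    field_simp
    ring
  have hgap : z * Q ^ 2 ≥ z / (3 * M) * Φ - n / 2 * e ^ 2 - z * r ^ 2 := by
    have h1 : (Q + s * e + r) ^ 2 ≤ 3 * (Q ^ 2 + s ^ 2 * e ^ 2 + r ^ 2) := by
      have h2 := sq_nonneg (Q - s * e)
      have h3 := sq_nonneg (Q - r)
      have h4 := sq_nonneg (s * e - r)
      linarith
    have h2 : Φ ≤ 3 * M * (Q ^ 2 + s ^ 2 * e ^ 2 + r ^ 2) :=
      H.gap_le.trans ((mul_le_mul_of_nonneg_left h1 hM.le).trans (le_of_eq (by ring)))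
    have h3 : z / (3 * M) * Φ ≤ z * (Q ^ 2 + s ^ 2 * e ^ 2 + r ^ 2) := by
      calc z / (3 * M) * Φ ≤ z / (3 * M) * (3 * M * (Q ^ 2 + s ^ 2 * e ^ 2 + r ^ 2)) := by gcongr
        _ = _ := by field_simp
    have h4 : z * s ^ 2 * e ^ 2 ≤ n / 2 * e ^ 2 := by gcongr
    linarith
  have hcoef : b * (p ^ 2 * lam) ≤ g * (A * p) + g * (α * q) + n * R := by
    have h1 : b * (p ^ 2 * lam)
        = g * (A * p) + (1 + n) * α * q * g + (1 + n) * α * q ^ 2 * n + n * p ^ 2 := by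
      rw [hb]; field_simp; ring
    have h2 : n * (α * q ^ 2 * n) ≤ 1 * (α * q ^ 2 * n) := by gcongr
    rw [h1, hR]
    linarith
  have hbe : b * σ = b - (g * A / p + (1 + n) * α * (q ^ 2 / p ^ 2) * (g / q + n) + n) := by
    have : σ = 1 - lam := by linarith
    rw [this, mul_sub, mul_one, hb]
    field_simp
  have hcons' := mul_le_mul_of_nonneg_left hcons hb0.le
  have hh : b * (p ^ 2 * lam) * h ^ 2 ≤ (g * (A * p) + g * (α * q) + m / 2) * h ^ 2 := by
    gcongr
    linarith
  have hmain : h' ^ 2 + b * e' ^ 2 + c * Φ' ≤ h ^ 2 + b * e ^ 2 + c * Φ - m / 2 * h ^ 2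
      - n * e ^ 2 - α * n * Q ^ 2 + C₁ * r ^ 2 := by
    have h1 : b * (σ * e ^ 2 + p ^ 2 * lam * h ^ 2)
        = (b * σ) * e ^ 2 + b * (p ^ 2 * lam) * h ^ 2 := by ring
    rw [h1, hbe] at hcons'
    have h2 : σ * h ^ 2 = h ^ 2 - (m + g * D) * h ^ 2 := by
      rw [hm, hlam]; ring
    have h3 : g * D = g * (A * p) + g * B + g * (α * q) := by rw [hD]; ring
    rw [h2, h3] at htrack
    have h4 : g * (A / p * e ^ 2 + B * h ^ 2 + α / q * Q ^ 2 + r ^ 2 / t)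
        = g * A / p * e ^ 2 + g * B * h ^ 2 + α * (g / q) * Q ^ 2 + g / t * r ^ 2 := by
      field_simp
    rw [h4] at htrack
    rw [hC₁]
    linarith
  have h1 : z * Q ^ 2 ≤ α * n * Q ^ 2 := by gcongr
  have h2 : η * h ^ 2 ≤ m / 2 * h ^ 2 := by gcongr
  have h3 : η * b * e ^ 2 ≤ n / 2 * e ^ 2 := by gcongr
  have h4 : η * c * Φ ≤ z / (3 * M) * Φ := mul_le_mul_of_nonneg_right hηc H.gap_nonneg
  linarith

/-! ### The augmented network and the limit of the powers of its matrix. -/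

open Matrix

theorem mul_apply_pos {ι : Type*} [Fintype ι] {A B : Matrix ι ι ℝ} (hA : ∀ i j, 0 ≤ A i j)
    (hB : ∀ i j, 0 ≤ B i j) {i k j : ι} (h₁ : 0 < A i k) (h₂ : 0 < B k j) : 0 < (A * B) i j :=
  (mul_pos h₁ h₂).trans_le
    (Finset.single_le_sum (f := fun k => A i k * B k j)
      (fun k _ => mul_nonneg (hA i k) (hB k j)) (Finset.mem_univ k))

theorem sum_embed {V : Type*} [Fintype V] {T : ℕ} (v : V → ℝ) : ∑ p, embed (T := T) v p = ∑ j, v j := by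
  rw [Fintype.sum_prod_type_right]
  refine Finset.sum_congr rfl fun j _ => ?_
  rw [Finset.sum_eq_single 0]
  · simp [embed]
  · intro r _ hr
    simp [embed, Fin.val_eq_zero_iff, hr]
  · simp

section Network

variable {V : Type*} [Fintype V] [DecidableEq V] {G : Digraph V} [DecidableRel G.Adj]
  {τ : V → V → ℕ} {T : ℕ}

theorem weight_nonneg (l i : V) : 0 ≤ weight G l i := by
  simp only [weight, of_apply]
  split_ifs <;> positivity

theorem weight_pos {l i : V} (h : l = i ∨ G.Adj i l) : 0 < weight G l i := by
  have : l = i ∨ l ∈ outNeighbors G i := by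
    rcases eq_or_ne l i with h' | h'
    · exact Or.inl h'
    · exact Or.inr (by simpa [outNeighbors, h'] using h)
  simp only [weight, of_apply, if_pos this]
  positivity

theorem sum_weight (i : V) : ∑ l, weight G l i = 1 := by
  have h1 : Finset.univ.filter (fun l => l = i ∨ l ∈ outNeighbors G i)
      = insert i (outNeighbors G i) := by
    ext l; simp
  have h2 : i ∉ outNeighbors G i := by simp [outNeighbors]
  simp only [weight, of_apply]
  rw [← Finset.sum_filter, h1, Finset.sum_const, Finset.card_insert_of_notMem h2, nsmul_eq_mul]
  push_cast
  field_simp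
  ring

theorem augMatrix_nonneg (p q : AugNode V T) : 0 ≤ augMatrix G τ T p q := by
  simp only [augMatrix, delayedWeight, of_apply]
  split_ifs <;> first | exact weight_nonneg _ _ | norm_num

theorem delay_le (hτ : DelaysBounded G τ T) {l i : V} (h : weight G l i ≠ 0) : τ l i ≤ T := by
  rcases eq_or_ne l i with rfl | hne
  · simp [hτ.1]
  · refine hτ.2 i l hne.symm ?_
    by_contra hadj
    simp [weight, outNeighbors, hne, hadj] at h

/-- In the column of an actual node each nonzero weight occurs in exactly one block, the one of its
delay, which exists as the delay is at most `T`. The column of a virtual node has a single entry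
`1`. -/
theorem augMatrix_mem_colStochastic (hτ : DelaysBounded G τ T) :
    augMatrix G τ T ∈ colStochastic ℝ (AugNode V T) := by
  rw [mem_colStochastic_iff_sum]
  refine ⟨augMatrix_nonneg, fun ⟨s, i⟩ => ?_⟩
  rw [Fintype.sum_prod_type_right]
  rcases Nat.eq_zero_or_pos (s : ℕ) with hs | hs
  · rw [← sum_weight (G := G) i]
    refine Finset.sum_congr rfl fun l _ => ?_
    simp only [augMatrix, of_apply, delayedWeight, if_pos hs]
    by_cases hw : weight G l i = 0
    · simp [hw]
    · rw [Finset.sum_eq_single (⟨τ l i, Nat.lt_succ_of_le (delay_le hτ hw)⟩ : Fin (T + 1))]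
      · simp
      · intro r _ hr
        rw [if_neg]
        exact fun h => hr (Fin.ext h.symm)
      · simp
  · rw [Finset.sum_eq_single i]
    · rw [Finset.sum_eq_single (⟨s - 1, by omega⟩ : Fin (T + 1))]
      · simp only [augMatrix, of_apply, if_neg hs.ne']
        rw [if_pos]
        exact ⟨(Nat.sub_add_cancel hs).symm, trivial⟩
      · intro r _ hr
        simp only [augMatrix, of_apply, if_neg hs.ne']
        rw [if_neg]
        rintro ⟨h, -⟩
        exact hr (Fin.ext (Nat.eq_sub_of_add_eq h.symm))
      · simp
    · intro l _ hl
      simp only [augMatrix, of_apply, if_neg hs.ne']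
      simp [hl]
    · simp

theorem augMatrix_self_pos (hτ : DelaysBounded G τ T) (j : V) :
    0 < augMatrix G τ T (0, j) (0, j) := by
  simpa [augMatrix, delayedWeight, hτ.1] using weight_pos (G := G) (Or.inl rfl)

theorem augMatrix_link_pos {i l : V} (hil : l = i ∨ G.Adj i l) (h : τ l i < T + 1) :
    0 < augMatrix G τ T (⟨τ l i, h⟩, l) (0, i) := by
  simpa [augMatrix, delayedWeight] using weight_pos hil

theorem augMatrix_shift {s : ℕ} (h : s + 1 < T + 1) (j : V) :
    augMatrix G τ T (⟨s, by omega⟩, j) (⟨s + 1, h⟩, j) = 1 := by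
  simp [augMatrix]

/-- In a strongly connected network some power of the augmented matrix has a positive row at any
given actual node. -/
theorem exists_pow_row_pos (hG : StronglyConnected G) (hτ : DelaysBounded G τ T) (j₀ : V) :
    ∃ m, 0 < m ∧ ∀ q, 0 < (augMatrix G τ T ^ m) (0, j₀) q := by
  have hM := augMatrix_mem_colStochastic hτ
  have hpow : ∀ k (p q : AugNode V T), 0 ≤ (augMatrix G τ T ^ k) p q :=
    fun k p q => (pow_mem hM k).1 p q
  have hstep : ∀ {p q : AugNode V T}, (∃ m, 0 < (augMatrix G τ T ^ m) (0, j₀) p) →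
      0 < augMatrix G τ T p q → ∃ m, 0 < (augMatrix G τ T ^ m) (0, j₀) q := by
    rintro p q ⟨m, hm⟩ h
    exact ⟨m + 1, by rw [pow_succ]; exact mul_apply_pos (hpow m) augMatrix_nonneg hm h⟩
  -- Mass at the virtual node `(s, j)` moves down to `(0, j)` in `s` steps.
  have hvirt : ∀ j, (∃ m, 0 < (augMatrix G τ T ^ m) (0, j₀) (0, j)) →
      ∀ s (hs : s < T + 1), ∃ m, 0 < (augMatrix G τ T ^ m) (0, j₀) (⟨s, hs⟩, j) := by
    intro j hj s
    induction s with
    | zero => exact fun _ => hj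
    | succ s ih =>
      intro hs
      exact hstep (ih (by omega)) (by rw [augMatrix_shift hs]; exact one_pos)
  -- Follow a walk from `i` to `j₀`: a link from `i` to `l` leads to the virtual node `(τ l i, l)`,
  -- and from there to `(0, l)`.
  have hact : ∀ i, ∃ m, 0 < (augMatrix G τ T ^ m) (0, j₀) (0, i) := by
    intro i
    induction hG i j₀ using Relation.ReflTransGen.head_induction_on with
    | refl => exact ⟨0, by simp⟩
    | @head i l hil _ ih =>
      have h : τ l i < T + 1 :=
        Nat.lt_succ_of_le (delay_le hτ (weight_pos (G := G) (Or.inr hil)).ne')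
      exact hstep (hvirt l ih _ h) (augMatrix_link_pos (Or.inr hil) h)
  have hall : ∀ q : AugNode V T, ∃ m, 0 < (augMatrix G τ T ^ m) (0, j₀) q :=
    fun q => hvirt q.2 (hact q.2) q.1 q.1.2
  choose m hm using hall
  have hmono : ∀ q d, 0 < (augMatrix G τ T ^ (m q + d)) (0, j₀) q := by
    intro q d
    induction d with
    | zero => exact hm q
    | succ d ih =>
      rw [← add_assoc, pow_succ']
      exact mul_apply_pos augMatrix_nonneg (hpow _) (augMatrix_self_pos hτ j₀) ih
  refine ⟨Finset.univ.sup m + 1, Nat.succ_pos _, fun q => ?_⟩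
  have hq : m q ≤ Finset.univ.sup m := Finset.le_sup (Finset.mem_univ q)
  have := hmono q (Finset.univ.sup m + 1 - m q)
  rwa [Nat.add_sub_cancel' (by omega)] at this

variable [Nontrivial V]

theorem tendsto_augMatrix_pow (hG : StronglyConnected G) (hτ : DelaysBounded G τ T) :
    Tendsto (fun k : ℕ => augMatrix G τ T ^ k) atTop (𝓝 (augLimit G τ T)) := by
  obtain ⟨j₀⟩ : Nonempty V := inferInstance
  obtain ⟨m, hm, hpos⟩ := exists_pow_row_pos hG hτ j₀
  refine tendsto_pi_nhds.2 fun p => tendsto_pi_nhds.2 fun q => ?_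
  exact tendsto_nhds_limUnder (exists_tendsto_pow (augMatrix_mem_colStochastic hτ) hm hpos p q)

theorem augLimit_mem_colStochastic (hG : StronglyConnected G) (hτ : DelaysBounded G τ T) :
    augLimit G τ T ∈ colStochastic ℝ (AugNode V T) :=
  limit_mem_colStochastic (augMatrix_mem_colStochastic hτ) (tendsto_augMatrix_pow hG hτ)

theorem augLimit_mulVec_eq_zero (hG : StronglyConnected G) (hτ : DelaysBounded G τ T)
    {a : AugNode V T → ℝ} (ha : ∑ p, a p = 0) : augLimit G τ T *ᵥ a = 0 := by
  obtain ⟨j₀⟩ : Nonempty V := inferInstance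
  obtain ⟨m, hm, hpos⟩ := exists_pow_row_pos hG hτ j₀
  exact limit_mulVec_eq_zero (augMatrix_mem_colStochastic hτ) hm hpos
    (tendsto_augMatrix_pow hG hτ) ha

/-- The vector `a - Ξ_∞ a` has sum zero, and `Ξ Ξ_∞ = Ξ_∞`, so the contraction on vectors of sum
zero is all that is needed. -/
theorem exists_isContractionNorm (hG : StronglyConnected G) (hτ : DelaysBounded G τ T) :
    ∃ (N : Seminorm ℝ (AugNode V T → ℝ)) (σ c d : ℝ), IsContractionNorm G τ T N σ c d := by
  obtain ⟨j₀⟩ : Nonempty V := inferInstance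
  obtain ⟨m, hm, hpos⟩ := exists_pow_row_pos hG hτ j₀
  obtain ⟨N, σ, c, d, h0, h1, hc, hd, hN, hNc, hNd⟩ :=
    exists_contracting_seminorm (augMatrix_mem_colStochastic hτ) hm hpos
  refine ⟨N, σ, c, d, h0, h1, hc, hd, fun a => ?_, hNc, hNd⟩
  have h := hN (a - augLimit G τ T *ᵥ a) (by
    simp [sum_mulVec_of_mem_colStochastic (augLimit_mem_colStochastic hG hτ)])
  rwa [mulVec_sub, mulVec_mulVec, mul_limit_eq (tendsto_augMatrix_pow hG hτ)] at h

end Network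

/-! ### The `y`-iterates, their limit and their suprema. -/

section YIterates

theorem embed_one_nonneg {V : Type*} {T : ℕ} (p : AugNode V T) :
    0 ≤ embed (fun _ : V => (1 : ℝ)) p := by
  simp only [embed]
  split_ifs <;> norm_num

variable {V : Type*} [Fintype V] [DecidableEq V] {G : Digraph V} [DecidableRel G.Adj]
  {τ : V → V → ℕ} {T : ℕ}

/-- The limit of the `y`-iterates. -/
noncomputable def yLim (G : Digraph V) [DecidableRel G.Adj] (τ : V → V → ℕ) (T : ℕ) :
    AugNode V T → ℝ :=
  augLimit G τ T *ᵥ embed fun _ => 1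

theorem yIter_succ (k : ℕ) : yIter G τ T (k + 1) = augMatrix G τ T *ᵥ yIter G τ T k := by
  simp only [yIter, mulVec_mulVec, pow_succ']

theorem yIter_nonneg (hτ : DelaysBounded G τ T) (k : ℕ) (p : AugNode V T) :
    0 ≤ yIter G τ T k p :=
  nonneg_mulVec_of_mem_colStochastic (pow_mem (augMatrix_mem_colStochastic hτ) k)
    embed_one_nonneg p

theorem yIter_zero_actual (j : V) : yIter G τ T 0 (0, j) = 1 := by
  simp [yIter, embed]

theorem yIter_pos (hτ : DelaysBounded G τ T) (k : ℕ) (j : V) : 0 < yIter G τ T k (0, j) := by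
  induction k with
  | zero => rw [yIter_zero_actual]; exact one_pos
  | succ k ih =>
    rw [yIter_succ]
    exact (mul_pos (augMatrix_self_pos hτ j) ih).trans_le
      (Finset.single_le_sum (f := fun q => augMatrix G τ T (0, j) q * yIter G τ T k q)
        (fun q _ => mul_nonneg (augMatrix_nonneg _ _) (yIter_nonneg hτ k q)) (Finset.mem_univ _))

variable [Nontrivial V]

theorem tendsto_yIter (hG : StronglyConnected G) (hτ : DelaysBounded G τ T) :
    Tendsto (fun k => yIter G τ T k) atTop (𝓝 (yLim G τ T)) :=
  tendsto_pow_mulVec (tendsto_augMatrix_pow hG hτ) _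

theorem sum_yLim (hG : StronglyConnected G) (hτ : DelaysBounded G τ T) :
    ∑ p, yLim G τ T p = Fintype.card V := by
  rw [yLim, sum_mulVec_of_mem_colStochastic (augLimit_mem_colStochastic hG hτ), sum_embed]
  simp

theorem augMatrix_pow_mulVec_yLim (hG : StronglyConnected G) (hτ : DelaysBounded G τ T) (k : ℕ) :
    (augMatrix G τ T ^ k) *ᵥ yLim G τ T = yLim G τ T := by
  induction k with
  | zero => simp
  | succ k ih =>
    rw [pow_succ, ← mulVec_mulVec, yLim, mulVec_mulVec _ (augMatrix G τ T),
      mul_limit_eq (tendsto_augMatrix_pow hG hτ), ← yLim, ih]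

/-- `yLim` is a nonnegative, nonzero fixed vector of `Ξ ^ m`, whose row at `(0, j)` is positive.
Together with convergence this bounds the reciprocals at actual nodes. -/
theorem yLim_pos (hG : StronglyConnected G) (hτ : DelaysBounded G τ T) (j : V) :
    0 < yLim G τ T (0, j) := by
  obtain ⟨m, -, hpos⟩ := exists_pow_row_pos hG hτ j
  have hnonneg : ∀ p, 0 ≤ yLim G τ T p :=
    nonneg_mulVec_of_mem_colStochastic (augLimit_mem_colStochastic hG hτ) embed_one_nonneg
  obtain ⟨q, hq⟩ : ∃ q, 0 < yLim G τ T q := by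
    by_contra! h
    have h1 := sum_yLim hG hτ
    have h2 : ∑ p, yLim G τ T p ≤ 0 := Finset.sum_nonpos fun p _ => h p
    have h3 : (0 : ℝ) < Fintype.card V := by exact_mod_cast Fintype.card_pos
    linarith
  rw [← augMatrix_pow_mulVec_yLim hG hτ m]
  exact (mul_pos (hpos q) hq).trans_le
    (Finset.single_le_sum (f := fun q => (augMatrix G τ T ^ m) (0, j) q * yLim G τ T q)
      (fun q _ => mul_nonneg (hpos q).le (hnonneg q)) (Finset.mem_univ q))

theorem bddAbove_yIter (hG : StronglyConnected G) (hτ : DelaysBounded G τ T) :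
    BddAbove (Set.range fun k : ℕ => matNorm2 (diagonal (yIter G τ T k))) := by
  simp only [matNorm2_diagonal]
  exact (tendsto_yIter hG hτ).norm.bddAbove_range

theorem bddAbove_yIter_inv (hG : StronglyConnected G) (hτ : DelaysBounded G τ T) :
    BddAbove (Set.range fun k : ℕ =>
      matNorm2 (diagonal fun j : V => (yIter G τ T k (0, j))⁻¹)) := by
  simp only [matNorm2_diagonal]
  have h : Tendsto (fun k => fun j : V => (yIter G τ T k (0, j))⁻¹) atTop
      (𝓝 fun j => (yLim G τ T (0, j))⁻¹) :=
    tendsto_pi_nhds.2 fun j =>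
      (tendsto_pi_nhds.1 (tendsto_yIter hG hτ) (0, j)).inv₀ (yLim_pos hG hτ j).ne'
  exact h.norm.bddAbove_range

theorem abs_yIter_le_ySup (hG : StronglyConnected G) (hτ : DelaysBounded G τ T) (k : ℕ)
    (p : AugNode V T) : |yIter G τ T k p| ≤ ySup G τ T := by
  refine le_trans ?_ (le_ciSup (bddAbove_yIter hG hτ) k)
  rw [matNorm2_diagonal]
  exact norm_le_pi_norm (yIter G τ T k) p

theorem yIter_inv_le_yInvSup (hG : StronglyConnected G) (hτ : DelaysBounded G τ T) (k : ℕ)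
    (j : V) : (yIter G τ T k (0, j))⁻¹ ≤ yInvSup G τ T := by
  refine le_trans ?_ (le_ciSup (bddAbove_yIter_inv hG hτ) k)
  rw [matNorm2_diagonal]
  exact (le_abs_self _).trans (norm_le_pi_norm (fun j : V => (yIter G τ T k (0, j))⁻¹) j)

theorem one_le_ySup (hG : StronglyConnected G) (hτ : DelaysBounded G τ T) : 1 ≤ ySup G τ T := by
  obtain ⟨j⟩ : Nonempty V := inferInstance
  simpa [yIter_zero_actual] using abs_yIter_le_ySup hG hτ 0 ((0, j) : AugNode V T)

theorem one_le_yInvSup (hG : StronglyConnected G) (hτ : DelaysBounded G τ T) :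
    1 ≤ yInvSup G τ T := by
  obtain ⟨j⟩ : Nonempty V := inferInstance
  simpa [yIter_zero_actual] using yIter_inv_le_yInvSup hG hτ 0 j

/-- `Ξ_∞` sends a vector to the multiple of the limit of the `y`-iterates with the same sum. -/
theorem augLimit_mulVec (hG : StronglyConnected G) (hτ : DelaysBounded G τ T)
    (a : AugNode V T → ℝ) :
    augLimit G τ T *ᵥ a = ((∑ p, a p) / Fintype.card V) • yLim G τ T := by
  have hn : (Fintype.card V : ℝ) ≠ 0 := by exact_mod_cast Fintype.card_ne_zero
  -- The initial `y`-vector has sum `n`, so this multiple of it has the same sum as `a`; `Ξ_∞`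
  -- annihilates the difference.
  have h0 : ∑ p, (a - ((∑ p, a p) / Fintype.card V) • embed fun _ => (1 : ℝ) : AugNode V T → ℝ) p = 0 := by
    simp only [Pi.sub_apply, Pi.smul_apply, Finset.sum_sub_distrib, smul_eq_mul, ← Finset.mul_sum,
      sum_embed]
    simp [hn]
  have h := augLimit_mulVec_eq_zero hG hτ h0
  rwa [mulVec_sub, mulVec_smul, sub_eq_zero] at h

/-- `Ξ_∞` annihilates the difference of two actual unit vectors, hence is not the identity. This is
where two distinct nodes are needed. -/
theorem eps_pos (hG : StronglyConnected G) (hτ : DelaysBounded G τ T) : 0 < eps G τ T := by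
  refine matNorm2_pos fun h => ?_
  obtain ⟨i, j, hij⟩ := exists_pair_ne V
  have h0 := augLimit_mulVec_eq_zero hG hτ
    (a := Pi.single ((0, i) : AugNode V T) 1 - Pi.single (0, j) 1) (by simp)
  rw [← sub_eq_zero.1 h, one_mulVec] at h0
  simpa [Pi.single_apply, hij] using congrFun h0 (0, i)

end YIterates

/-! ### From the step-size bound to the small-gain condition. -/

section StepSize

theorem two_le_augSize {V : Type*} [Fintype V] [Nontrivial V] {T : ℕ} : 2 ≤ augSize V T := by
  have h1 : (2 : ℝ) ≤ Fintype.card V := by exact_mod_cast Fintype.one_lt_card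
  have h2 : (1 : ℝ) ≤ (T : ℝ) + 1 := by linarith [(Nat.cast_nonneg T : (0 : ℝ) ≤ T)]
  calc (2 : ℝ) = 2 * 1 := by norm_num
    _ ≤ Fintype.card V * ((T : ℝ) + 1) := by gcongr

/-- The quadratic inequality that is equivalent to a bound on the step size. -/
theorem quadratic_lt_of_lt_root {θ δ β α : ℝ} (hθ : 0 < θ) (hα : 0 ≤ α) (hδ : 0 ≤ δ)
    (h : α < (√(δ ^ 2 + 4 * β * θ) - δ) / (2 * θ)) : θ * α ^ 2 + δ * α < β := by
  rw [lt_div_iff₀ (by positivity)] at h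
  have h1 : (α * (2 * θ) + δ) ^ 2 < δ ^ 2 + 4 * β * θ :=
    (Real.lt_sqrt (by positivity)).1 (by linarith)
  have h2 : 4 * θ * (θ * α ^ 2 + δ * α) < 4 * θ * β := by linarith
  exact lt_of_mul_lt_mul_left h2 (by positivity)

/-- The step-size condition implies the small-gain condition of the error dynamics. -/
theorem small_gain_of_step_size {nb L μ σ c d ε Y Z ξ α : ℝ} (hnb : 2 ≤ nb) (hμ : 0 < μ)
    (hμL : μ ≤ L) (hσ : σ < 1) (hc : 0 < c) (hd : 0 < d) (hε : 0 < ε) (hY : 1 ≤ Y) (hZ : 1 ≤ Z)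
    (hα : 0 < α) (hαL : α < 1 / (nb * L))
    (hquad : c * d * ε * L ^ 2 * Y * Z ^ 2 * (L + nb * μ) * α ^ 2
      + nb * μ * c * d * ε * L * Z * (1 - σ + ξ) * α < nb * μ * (1 - σ) ^ 2) :
    0 < 1 - α * L + α * μ / 2 ∧
      d * ε * L * (Z * ξ * c * (α / (1 - σ)) + Z * c * α
        + α * (L * (Z * c) * (α / (1 - σ)) / (1 - α * L + α * μ / 2))) < 1 - σ := by
  have hL : 0 < L := hμ.trans_le hμL
  have hlam : 0 < 1 - σ := by linarith
  rw [lt_div_iff₀ (by positivity)] at hαL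
  have h2 : α * L * 2 ≤ α * (nb * L) := by
    have : 0 < α * L := by positivity
    nlinarith
  have hκ : 0 < 1 - α * L + α * μ / 2 := by
    have : 0 < α * μ := by positivity
    linarith
  refine ⟨hκ, ?_⟩
  obtain ⟨κ, hκdef⟩ : ∃ κ, κ = 1 - α * L + α * μ / 2 := ⟨_, rfl⟩
  rw [← hκdef] at hκ ⊢
  -- This is the lower bound `κ ≥ nb μ / (L + nb μ)`. It rests on `α nb L < 1`, with `nb ≥ 2` and `μ
  -- ≤ L`.
  have hkey : nb * μ ≤ κ * (L + nb * μ) := by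
    have h3 : (L - μ / 2) * (L + nb * μ) ≤ L * (nb * L) := by
      have h4 : 0 ≤ (nb - 2) * (L ^ 2 - μ * L + μ ^ 2 / 2) := by
        apply mul_nonneg (by linarith)
        nlinarith [sq_nonneg (L - μ)]
      nlinarith [sq_nonneg (L - μ)]
    have h5 : α * ((L - μ / 2) * (L + nb * μ)) ≤ L := by
      calc α * ((L - μ / 2) * (L + nb * μ)) ≤ α * (L * (nb * L)) := by gcongr
        _ = α * (nb * L) * L := by ring
        _ ≤ 1 * L := by gcongr
        _ = L := one_mul L
    have h6 : κ * (L + nb * μ) = L + nb * μ - α * ((L - μ / 2) * (L + nb * μ)) := by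
      rw [hκdef]; ring
    linarith
  have hinv : 1 / κ ≤ (L + nb * μ) / (nb * μ) := by
    rw [div_le_div_iff₀ hκ (by positivity)]
    linarith
  have hdiv : c * d * ε * L * Z * α * (1 - σ + ξ + α * L * (Y * Z) * ((L + nb * μ) / (nb * μ)))
      < (1 - σ) ^ 2 := by
    have h7 : nb * μ * (c * d * ε * L * Z * α
        * (1 - σ + ξ + α * L * (Y * Z) * ((L + nb * μ) / (nb * μ)))) < nb * μ * (1 - σ) ^ 2 := by
      refine lt_of_eq_of_lt ?_ hquad
      field_simp
      ring
    exact lt_of_mul_lt_mul_left h7 (by positivity)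
  -- The loop gain contains no factor `Y * Z` where the quadratic condition has one; being at least
  -- `1`, it can be dropped.
  have hYZ : 1 ≤ Y * Z := one_le_mul_of_one_le_of_one_le hY hZ
  have hbound : c * d * ε * L * Z * α * (1 - σ + ξ + α * L * 1 * (1 / κ))
      ≤ c * d * ε * L * Z * α * (1 - σ + ξ + α * L * (Y * Z) * ((L + nb * μ) / (nb * μ))) := by
    gcongr
  have hfin : d * ε * L * (Z * ξ * c * (α / (1 - σ)) + Z * c * α
        + α * (L * (Z * c) * (α / (1 - σ)) / κ))
      = c * d * ε * L * Z * α * (1 - σ + ξ + α * L * 1 * (1 / κ)) / (1 - σ) := by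
    field_simp
    ring
  rw [hfin, div_lt_iff₀ hlam]
  linarith

variable {V : Type*} [Fintype V] [DecidableEq V] [Nontrivial V] {G : Digraph V}
  [DecidableRel G.Adj] {τ : V → V → ℕ} {T : ℕ} {L μ σ c d : ℝ}
  {N : Seminorm ℝ (AugNode V T → ℝ)}

theorem theta_pos (hG : StronglyConnected G) (hτ : DelaysBounded G τ T) (hL : 0 < L)
    (hμ : 0 < μ) (hc : 0 < c) (hd : 0 < d) : 0 < theta G τ T L μ c d := by
  have h1 := one_le_ySup hG hτ
  have h2 := one_le_yInvSup hG hτ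
  have h3 := eps_pos hG hτ
  have h4 := two_le_augSize (V := V) (T := T)
  unfold theta
  positivity

theorem delta_nonneg (hG : StronglyConnected G) (hτ : DelaysBounded G τ T) (hL : 0 < L)
    (hμ : 0 < μ) (hN : IsContractionNorm G τ T N σ c d) : 0 ≤ delta G τ T L μ σ c d := by
  have h2 := one_le_yInvSup hG hτ
  have h3 := eps_pos hG hτ
  have h4 := two_le_augSize (V := V) (T := T)
  have h5 : 0 ≤ xi G τ T := matNorm2_nonneg _
  have h6 : 0 ≤ 1 - σ + xi G τ T := by linarith [hN.sigma_lt_one]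
  have := hN.c_pos
  have := hN.d_pos
  unfold delta
  positivity

theorem alphaBar_pos (hG : StronglyConnected G) (hτ : DelaysBounded G τ T) (hL : 0 < L)
    (hμ : 0 < μ) (hN : IsContractionNorm G τ T N σ c d) : 0 < alphaBar G τ T L μ σ c d := by
  have h1 := theta_pos hG hτ hL hμ hN.c_pos hN.d_pos
  have h2 := delta_nonneg hG hτ hL hμ hN
  have h3 := two_le_augSize (V := V) (T := T)
  have h4 : 0 < 1 - σ := by linarith [hN.sigma_lt_one]
  refine lt_min (div_pos ?_ (by positivity)) (by positivity)
  rw [sub_pos]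
  refine Real.lt_sqrt_of_sq_lt ?_
  have : 0 < 4 * augSize V T * μ * (1 - σ) ^ 2 * theta G τ T L μ c d := by positivity
  linarith

theorem small_gain_of_lt_alphaBar (hG : StronglyConnected G) (hτ : DelaysBounded G τ T)
    (hμ : 0 < μ) (hμL : μ ≤ L) (hN : IsContractionNorm G τ T N σ c d) {α : ℝ} (hα : 0 < α)
    (h : α < alphaBar G τ T L μ σ c d) :
    0 < 1 - α * L + α * μ / 2 ∧
      d * eps G τ T * L * (yInvSup G τ T * xi G τ T * c * (α / (1 - σ)) + yInvSup G τ T * c * α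
        + α * (L * (yInvSup G τ T * c) * (α / (1 - σ)) / (1 - α * L + α * μ / 2))) < 1 - σ := by
  have hL : 0 < L := hμ.trans_le hμL
  refine small_gain_of_step_size two_le_augSize hμ hμL hN.sigma_lt_one hN.c_pos hN.d_pos
    (eps_pos hG hτ) (one_le_ySup hG hτ) (one_le_yInvSup hG hτ) hα
    (h.trans_le (min_le_right _ _)) ?_
  have h1 := quadratic_lt_of_lt_root (β := augSize V T * μ * (1 - σ) ^ 2)
    (theta_pos hG hτ hL hμ hN.c_pos hN.d_pos) hα.le (delta_nonneg hG hτ hL hμ hN)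
    (by simpa only [mul_assoc] using h.trans_le (min_le_left _ _))
  simpa only [theta, delta] using h1

end StepSize

/-! ### The strongly convex objective and inexact gradient steps. -/

section Objective

/-- Adding the strong convexity inequalities between `0` and `1` gives `μ ≤ f' 1 - f' 0 ≤ L`. -/
theorem LocalAssumptions.mu_le_L {V : Type*} [Nonempty V] {f : V → ℝ → ℝ} {L μ : ℝ}
    (hf : LocalAssumptions f L μ) : μ ≤ L := by
  obtain ⟨j⟩ : Nonempty V := inferInstance
  have h1 := hf.strongly_convex j 0 1
  have h2 := hf.strongly_convex j 1 0
  have h3 := (abs_le.1 (hf.lipschitz j 1 0)).2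
  norm_num at h1 h2 h3
  linarith

variable {V : Type*} [Fintype V] {f : V → ℝ → ℝ} {L μ : ℝ}

/-- The derivative of the objective. -/
noncomputable def objectiveGrad (f : V → ℝ → ℝ) (z : ℝ) : ℝ :=
  1 / (Fintype.card V : ℝ) * ∑ j, deriv (f j) z

theorem objective_sub_le [Nonempty V] (hf : LocalAssumptions f L μ) (a b : ℝ) :
    objective f a - objective f b ≤ objectiveGrad f a * (a - b) - μ / 2 * (a - b) ^ 2 := by
  have hn : (0 : ℝ) < Fintype.card V := by exact_mod_cast Fintype.card_pos
  have h : ∑ j, (f j a - f j b) ≤ ∑ j, (deriv (f j) a * (a - b) - μ / 2 * (a - b) ^ 2) :=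
    Finset.sum_le_sum fun j _ => by simpa using hf.strongly_convex j a b
  rw [Finset.sum_sub_distrib, Finset.sum_sub_distrib, ← Finset.sum_mul, Finset.sum_const,
    Finset.card_univ, nsmul_eq_mul] at h
  calc objective f a - objective f b
      = 1 / (Fintype.card V : ℝ) * (∑ j, f j a - ∑ j, f j b) := by simp only [objective]; ring
    _ ≤ 1 / (Fintype.card V : ℝ) * ((∑ j, deriv (f j) a) * (a - b)
          - Fintype.card V * (μ / 2 * (a - b) ^ 2)) := by gcongr
    _ = _ := by simp only [objectiveGrad]; field_simp

theorem abs_objectiveGrad_sub_le [Nonempty V] (hf : LocalAssumptions f L μ) (a b : ℝ) :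
    |objectiveGrad f a - objectiveGrad f b| ≤ L * |a - b| := by
  have hn : (0 : ℝ) < Fintype.card V := by exact_mod_cast Fintype.card_pos
  rw [objectiveGrad, objectiveGrad, ← mul_sub, ← Finset.sum_sub_distrib, abs_mul,
    abs_of_pos (by positivity), one_div_mul_eq_div, div_le_iff₀ hn]
  refine (Finset.abs_sum_le_sum_abs _ _).trans
    ((Finset.sum_le_sum fun j _ => hf.lipschitz j a b).trans_eq ?_)
  simp [mul_comm]

theorem objectiveGrad_strongly_monotone [Nonempty V] (hf : LocalAssumptions f L μ) (a b : ℝ) :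
    μ * (a - b) ^ 2 ≤ (objectiveGrad f a - objectiveGrad f b) * (a - b) := by
  have h1 := objective_sub_le hf a b
  have h2 := objective_sub_le hf b a
  linarith

/-- Strong monotonicity forces the gradient to be nonnegative at `R` and nonpositive at `-R` for
large `R`; the intermediate value theorem does the rest. -/
theorem exists_objectiveGrad_eq_zero [Nonempty V] (hf : LocalAssumptions f L μ) :
    ∃ z, objectiveGrad f z = 0 := by
  have hcont : Continuous (objectiveGrad f) :=
    (LipschitzWith.of_dist_le_mul (K := L.toNNReal) fun a b => by
      rw [Real.coe_toNNReal L hf.L_pos.le]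
      exact abs_objectiveGrad_sub_le hf a b).continuous
  have hμ := hf.mu_pos
  set R : ℝ := |objectiveGrad f 0| / μ + 1 with hR
  have hR0 : 0 < R := by positivity
  have hRg : |objectiveGrad f 0| ≤ μ * R := by
    rw [hR, mul_add, mul_div_cancel₀ _ hμ.ne']
    linarith
  have h1 : 0 ≤ objectiveGrad f R := by
    have h := objectiveGrad_strongly_monotone hf R 0
    have h' : μ * R ≤ objectiveGrad f R - objectiveGrad f 0 :=
      le_of_mul_le_mul_right (by linarith) hR0
    linarith [neg_abs_le (objectiveGrad f 0)]
  have h2 : objectiveGrad f (-R) ≤ 0 := by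
    have h := objectiveGrad_strongly_monotone hf (-R) 0
    have h' : μ * R ≤ objectiveGrad f 0 - objectiveGrad f (-R) :=
      le_of_mul_le_mul_right (by linarith) hR0
    linarith [le_abs_self (objectiveGrad f 0)]
  obtain ⟨z, -, hz⟩ :=
    intermediate_value_Icc (by linarith : -R ≤ R) hcont.continuousOn ⟨h2, h1⟩
  exact ⟨z, hz⟩

theorem quadratic_growth [Nonempty V] (hf : LocalAssumptions f L μ) {zs : ℝ}
    (hzs : objectiveGrad f zs = 0) (z : ℝ) :
    μ / 2 * (z - zs) ^ 2 ≤ objective f z - objective f zs := by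
  have h := objective_sub_le hf zs z
  rw [hzs] at h
  linarith

/-- The Polyak-Łojasiewicz inequality. -/
theorem objective_gap_le [Nonempty V] (hf : LocalAssumptions f L μ) (z zs : ℝ) :
    objective f z - objective f zs ≤ 1 / (2 * μ) * objectiveGrad f z ^ 2 := by
  have hμ := hf.mu_pos
  have h := objective_sub_le hf z zs
  have h1 : 1 / (2 * μ) * objectiveGrad f z ^ 2
      - (objectiveGrad f z * (z - zs) - μ / 2 * (z - zs) ^ 2)
      = 1 / (2 * μ) * (objectiveGrad f z - μ * (z - zs)) ^ 2 := by
    field_simp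
    ring
  have h2 : 0 ≤ 1 / (2 * μ) * (objectiveGrad f z - μ * (z - zs)) ^ 2 := by positivity
  linarith

/-- The descent of the objective in a gradient step with an inexact gradient `q`. -/
theorem objective_step_le [Nonempty V] (hf : LocalAssumptions f L μ) {α : ℝ} (hα : 0 < α)
    (u q : ℝ) :
    objective f (u - α * q) ≤ objective f u - α * (1 - α * L + α * μ / 2) * q ^ 2
      + α * |q| * |q - objectiveGrad f u| := by
  -- Strong convexity is used at the new point, and the Lipschitz bound moves its gradient back to
  -- `u`. This gives `L - μ / 2` in the coefficient of descent.
  have h1 := objective_sub_le hf (u - α * q) u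
  have h2 : (objectiveGrad f (u - α * q) - objectiveGrad f u) * (-(α * q))
      ≤ L * (α * q) ^ 2 := by
    refine (le_abs_self _).trans ?_
    rw [abs_mul, abs_neg]
    calc _ ≤ L * |u - α * q - u| * |α * q| := by
          gcongr
          exact abs_objectiveGrad_sub_le hf _ _
      _ = L * |α * q| ^ 2 := by
          rw [sub_sub_cancel_left, abs_neg]
          ring
      _ = L * (α * q) ^ 2 := by rw [sq_abs]
  have h3 : α * (q * (q - objectiveGrad f u)) ≤ α * (|q| * |q - objectiveGrad f u|) := by
    rw [← abs_mul]
    gcongr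
    exact le_abs_self _
  have h4 : u - α * q - u = -(α * q) := by ring
  rw [h4] at h1
  linarith

end Objective

/-! ### Passage between actual and augmented vectors. -/

section Embed

theorem embed_sub {V : Type*} {T : ℕ} (v w : V → ℝ) : embed (T := T) v - embed w = embed (v - w) := by
  ext p
  simp only [embed, Pi.sub_apply]
  split_ifs <;> simp

variable {V : Type*} [Fintype V] {T : ℕ}

theorem norm2_embed (v : V → ℝ) : norm2 (embed (T := T) v) = norm2 v := by
  have h : ∀ p : AugNode V T, embed v p ^ 2 = embed (T := T) (fun j => v j ^ 2) p := by
    intro p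
    simp only [embed]
    split_ifs <;> simp
  have h2 : ∑ p, embed (T := T) v p ^ 2 = ∑ j, v j ^ 2 := by
    simp only [h, sum_embed]
  exact le_antisymm (norm2_le_norm2 h2.le) (norm2_le_norm2 h2.ge)

theorem norm2_actual_le (a : AugNode V T → ℝ) : norm2 (fun j => a (0, j)) ≤ norm2 a := by
  refine norm2_le_norm2 ?_
  rw [Fintype.sum_prod_type]
  exact Finset.single_le_sum (f := fun r => ∑ j, a (r, j) ^ 2)
    (fun r _ => Finset.sum_nonneg fun j _ => sq_nonneg _) (Finset.mem_univ 0)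

end Embed

/-! ### Geometric convergence of the `y`-iterates. -/

section Contraction

variable {V : Type*} [Fintype V] [DecidableEq V] [Nontrivial V] {G : Digraph V}
  [DecidableRel G.Adj] {τ : V → V → ℕ} {T : ℕ} {σ c d : ℝ}
  {N : Seminorm ℝ (AugNode V T → ℝ)}

/-- The distance of the `y`-iterate from its limit. -/
noncomputable def yDev (G : Digraph V) [DecidableRel G.Adj] (τ : V → V → ℕ) (T k : ℕ) : ℝ :=
  norm2 (yIter G τ T k - yLim G τ T)

/-- `y_0 - yLim` has sum zero, and on such vectors `Ξ_∞` vanishes, so the hypothesis on `N` becomes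
a plain contraction. -/
theorem exists_yDev_le (hG : StronglyConnected G) (hτ : DelaysBounded G τ T)
    (hN : IsContractionNorm G τ T N σ c d) : ∃ C, 0 ≤ C ∧ ∀ k, yDev G τ T k ≤ C * σ ^ k := by
  have hc := hN.c_pos
  refine ⟨c * N (yIter G τ T 0 - yLim G τ T), by positivity, fun k => ?_⟩
  have hzero : ∀ a : AugNode V T → ℝ, ∑ p, a p = 0 → N (augMatrix G τ T *ᵥ a) ≤ σ * N a := by
    intro a ha
    have h := hN.contraction a
    rwa [augLimit_mulVec_eq_zero hG hτ ha, sub_zero, sub_zero] at h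
  have hsum : ∑ p, (yIter G τ T 0 - yLim G τ T) p = 0 := by
    simp only [Pi.sub_apply, Finset.sum_sub_distrib, sum_yLim hG hτ]
    simp [yIter, sum_embed]
  have hy : yIter G τ T k - yLim G τ T
      = (augMatrix G τ T ^ k) *ᵥ (yIter G τ T 0 - yLim G τ T) := by
    rw [mulVec_sub, augMatrix_pow_mulVec_yLim hG hτ]
    simp [yIter]
  have h := seminorm_pow_mulVec_le (augMatrix_mem_colStochastic hτ) hN.sigma_nonneg hzero hsum k
  rw [← hy] at h
  calc yDev G τ T k ≤ c * N (yIter G τ T k - yLim G τ T) := hN.norm2_le _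
    _ ≤ c * (σ ^ k * N (yIter G τ T 0 - yLim G τ T)) := by gcongr
    _ = _ := by ring

end Contraction

/-! ### One step of the algorithm: means, disagreements and estimates. -/

section Dynamics

section State

variable {V : Type*} [Fintype V] {T : ℕ}

/-- The mean of the `x`-iterate. -/
noncomputable def State.mean (s : State V T) : ℝ := (∑ p, s.x p) / Fintype.card V

/-- The mean of the local derivatives at the local estimates. -/
noncomputable def State.meanGrad (f : V → ℝ → ℝ) (s : State V T) : ℝ :=
  (∑ j, deriv (f j) (s.z j)) / Fintype.card V

/-- The deviation of the local estimates from the mean. -/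
noncomputable def State.dev (s : State V T) : V → ℝ := fun j => s.z j - s.mean

variable {f : V → ℝ → ℝ} {L μ : ℝ}

theorem State.sqrt_card_mul_abs_meanGrad_sub_le [Nonempty V] (hf : LocalAssumptions f L μ)
    (s : State V T) :
    √(Fintype.card V) * |s.meanGrad f - objectiveGrad f s.mean| ≤ L * norm2 s.dev := by
  have hn : (0 : ℝ) < Fintype.card V := by exact_mod_cast Fintype.card_pos
  have hL := hf.L_pos
  have h1 : s.meanGrad f - objectiveGrad f s.mean
      = (∑ j, (deriv (f j) (s.z j) - deriv (f j) s.mean)) / Fintype.card V := by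
    rw [Finset.sum_sub_distrib, State.meanGrad, objectiveGrad]
    ring
  have h2 : |∑ j, (deriv (f j) (s.z j) - deriv (f j) s.mean)|
      ≤ L * (√(Fintype.card V) * norm2 s.dev) := by
    refine (Finset.abs_sum_le_sum_abs _ _).trans
      ((Finset.sum_le_sum fun j _ => hf.lipschitz j _ _).trans ?_)
    rw [← Finset.mul_sum]
    gcongr
    exact sum_abs_le_sqrt_card_mul_norm2 s.dev
  rw [h1, abs_div, abs_of_pos hn, mul_div_assoc', div_le_iff₀ hn]
  calc √(Fintype.card V) * |∑ j, (deriv (f j) (s.z j) - deriv (f j) s.mean)|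
      ≤ √(Fintype.card V) * (L * (√(Fintype.card V) * norm2 s.dev)) := by gcongr
    _ = L * norm2 s.dev * (√(Fintype.card V) * √(Fintype.card V)) := by ring
    _ = L * norm2 s.dev * Fintype.card V := by rw [Real.mul_self_sqrt hn.le]

theorem State.norm2_z_le (s : State V T) :
    norm2 s.z ≤ norm2 s.dev + √(Fintype.card V) * |s.mean| := by
  have h : s.z = s.dev + fun _ => s.mean := by
    ext j
    simp [State.dev]
  rw [h, ← norm2_const]
  exact norm2_add_le _ _

end State

variable {V : Type*} [Fintype V] [DecidableEq V] {G : Digraph V} [DecidableRel G.Adj] {τ : V → V → ℕ} {T : ℕ}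
  {f : V → ℝ → ℝ} {L μ σ c d α : ℝ} {N : Seminorm ℝ (AugNode V T → ℝ)} {x0 z0 : V → ℝ}

theorem iterate_x_succ (k : ℕ) : (iterate G τ T f α x0 z0 (k + 1)).x
    = augMatrix G τ T *ᵥ (iterate G τ T f α x0 z0 k).x - α • (iterate G τ T f α x0 z0 k).w := rfl

theorem iterate_w_succ (k : ℕ) : (iterate G τ T f α x0 z0 (k + 1)).w
    = augMatrix G τ T *ᵥ (iterate G τ T f α x0 z0 k).w
      + embed (fun j => deriv (f j) ((iterate G τ T f α x0 z0 (k + 1)).z j))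
      - embed (fun j => deriv (f j) ((iterate G τ T f α x0 z0 k).z j)) := rfl

/-- Available only from the first step on, since `z0` is unrelated to `x0`. This is why the later
estimates start at index `k + 1`. -/
theorem yIter_mul_iterate_z_succ (hτ : DelaysBounded G τ T) (k : ℕ) (j : V) :
    yIter G τ T (k + 1) (0, j) * (iterate G τ T f α x0 z0 (k + 1)).z j
      = (iterate G τ T f α x0 z0 (k + 1)).x (0, j) := by
  have h : (iterate G τ T f α x0 z0 (k + 1)).z j
      = (iterate G τ T f α x0 z0 (k + 1)).x (0, j) / (iterate G τ T f α x0 z0 (k + 1)).y (0, j) :=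
    rfl
  rw [h, iterate_y, mul_div_cancel₀ _ (yIter_pos hτ _ j).ne']

/-- The conservation law of gradient tracking: `Ξ` preserves sums, the gradient increments
telescope, and the law holds at the start by the choice of `w_0`. -/
theorem sum_iterate_w (hτ : DelaysBounded G τ T) (k : ℕ) :
    ∑ p, (iterate G τ T f α x0 z0 k).w p
      = ∑ j, deriv (f j) ((iterate G τ T f α x0 z0 k).z j) := by
  induction k with
  | zero => exact sum_embed fun j => deriv (f j) (z0 j)
  | succ k ih =>
    rw [iterate_w_succ]
    simp only [Pi.sub_apply, Pi.add_apply, Finset.sum_sub_distrib, Finset.sum_add_distrib,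
      sum_embed, sum_mulVec_of_mem_colStochastic (augMatrix_mem_colStochastic hτ), ih]
    ring

theorem iterate_mean_succ (hτ : DelaysBounded G τ T) (k : ℕ) :
    (iterate G τ T f α x0 z0 (k + 1)).mean = (iterate G τ T f α x0 z0 k).mean
      - α * (iterate G τ T f α x0 z0 k).meanGrad f := by
  simp only [State.mean, State.meanGrad, iterate_x_succ, ← sum_iterate_w hτ, Pi.sub_apply,
    Pi.smul_apply, smul_eq_mul, Finset.sum_sub_distrib, ← Finset.mul_sum,
    sum_mulVec_of_mem_colStochastic (augMatrix_mem_colStochastic hτ)]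
  ring

variable [Nontrivial V]

theorem augLimit_mulVec_x (hG : StronglyConnected G) (hτ : DelaysBounded G τ T) (k : ℕ) :
    augLimit G τ T *ᵥ (iterate G τ T f α x0 z0 k).x
      = (iterate G τ T f α x0 z0 k).mean • yLim G τ T :=
  augLimit_mulVec hG hτ _

theorem augLimit_mulVec_w (hG : StronglyConnected G) (hτ : DelaysBounded G τ T) (k : ℕ) :
    augLimit G τ T *ᵥ (iterate G τ T f α x0 z0 k).w
      = (iterate G τ T f α x0 z0 k).meanGrad f • yLim G τ T := by
  rw [augLimit_mulVec hG hτ, sum_iterate_w hτ, State.meanGrad]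

/-- The distance of a vector from its image under `Ξ_∞`, in the contraction norm. -/
noncomputable def disagreement (G : Digraph V) [DecidableRel G.Adj] (τ : V → V → ℕ)
    (N : Seminorm ℝ (AugNode V T → ℝ)) (a : AugNode V T → ℝ) : ℝ :=
  N (a - augLimit G τ T *ᵥ a)

theorem disagreement_x_succ_le (hG : StronglyConnected G) (hτ : DelaysBounded G τ T)
    (hN : IsContractionNorm G τ T N σ c d) (hα : 0 < α) (k : ℕ) :
    disagreement G τ N (iterate G τ T f α x0 z0 (k + 1)).x
      ≤ σ * disagreement G τ N (iterate G τ T f α x0 z0 k).x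
        + α * disagreement G τ N (iterate G τ T f α x0 z0 k).w := by
  set s := iterate G τ T f α x0 z0 k
  have h : (iterate G τ T f α x0 z0 (k + 1)).x
        - augLimit G τ T *ᵥ (iterate G τ T f α x0 z0 (k + 1)).x
      = (augMatrix G τ T *ᵥ s.x - augLimit G τ T *ᵥ s.x)
        - α • (s.w - augLimit G τ T *ᵥ s.w) := by
    rw [iterate_x_succ, mulVec_sub, mulVec_mulVec, limit_mul_eq (tendsto_augMatrix_pow hG hτ),
      mulVec_smul, smul_sub]
    abel
  rw [disagreement, h]
  calc _ ≤ N (augMatrix G τ T *ᵥ s.x - augLimit G τ T *ᵥ s.x)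
        + N (α • (s.w - augLimit G τ T *ᵥ s.w)) := map_sub_le_add N _ _
    _ ≤ _ := by
      rw [map_smul_eq_mul, Real.norm_of_nonneg hα.le]
      exact add_le_add_left (hN.contraction s.x) _

/-- The gradient increment enters through `I - Ξ_∞`, whence `ε`; `d` comes from the change of norms
and `L` from the local derivatives. -/
theorem disagreement_w_succ_le (hG : StronglyConnected G) (hτ : DelaysBounded G τ T)
    (hf : LocalAssumptions f L μ) (hN : IsContractionNorm G τ T N σ c d) (k : ℕ) :
    disagreement G τ N (iterate G τ T f α x0 z0 (k + 1)).w
      ≤ σ * disagreement G τ N (iterate G τ T f α x0 z0 k).w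
        + d * eps G τ T * L
          * norm2 ((iterate G τ T f α x0 z0 (k + 1)).z - (iterate G τ T f α x0 z0 k).z) := by
  set s := iterate G τ T f α x0 z0 k
  set s' := iterate G τ T f α x0 z0 (k + 1)
  set v : V → ℝ := fun j => deriv (f j) (s'.z j) - deriv (f j) (s.z j)
  have hL := hf.L_pos
  have hd := hN.d_pos
  have he := eps_pos hG hτ
  have h : s'.w - augLimit G τ T *ᵥ s'.w
      = (augMatrix G τ T *ᵥ s.w - augLimit G τ T *ᵥ s.w)
        + (1 - augLimit G τ T) *ᵥ embed v := by
    have hw : s'.w = augMatrix G τ T *ᵥ s.w + embed v := by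
      rw [iterate_w_succ, add_sub_assoc, embed_sub]
      rfl
    rw [hw, mulVec_add, mulVec_mulVec, limit_mul_eq (tendsto_augMatrix_pow hG hτ), sub_mulVec,
      one_mulVec]
    abel
  have hv : norm2 v ≤ L * norm2 (s'.z - s.z) :=
    norm2_le_mul_norm2 hL.le fun j => hf.lipschitz j _ _
  have h2 : N ((1 - augLimit G τ T) *ᵥ embed v)
      ≤ d * eps G τ T * L * norm2 (s'.z - s.z) := by
    calc N ((1 - augLimit G τ T) *ᵥ embed v)
        ≤ d * norm2 ((1 - augLimit G τ T) *ᵥ embed v) := hN.le_norm2 _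
      _ ≤ d * (eps G τ T * norm2 v) := by
          gcongr
          rw [← norm2_embed (T := T) v]
          exact norm2_mulVec_le _ _
      _ ≤ d * (eps G τ T * (L * norm2 (s'.z - s.z))) := by gcongr
      _ = _ := by ring
  rw [disagreement, h]
  exact (map_add_le_add N _ _).trans (add_le_add (hN.contraction s.w) h2)

/-- At actual nodes, `y (z - mean) = x - mean * y = (x - Ξ_∞ x) - mean * (y - yLim)`. -/
theorem norm2_dev_succ_le (hG : StronglyConnected G) (hτ : DelaysBounded G τ T)
    (hN : IsContractionNorm G τ T N σ c d) (k : ℕ) :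
    norm2 (iterate G τ T f α x0 z0 (k + 1)).dev
      ≤ yInvSup G τ T * c * disagreement G τ N (iterate G τ T f α x0 z0 (k + 1)).x
        + yInvSup G τ T * yDev G τ T (k + 1) * |(iterate G τ T f α x0 z0 (k + 1)).mean| := by
  have hZ := one_le_yInvSup hG hτ
  have hz := yIter_mul_iterate_z_succ (f := f) (α := α) (x0 := x0) (z0 := z0) hτ k
  have hJ := augLimit_mulVec_x (f := f) (α := α) (x0 := x0) (z0 := z0) hG hτ (k + 1)
  set s := iterate G τ T f α x0 z0 (k + 1)
  set a : AugNode V T → ℝ := (s.x - augLimit G τ T *ᵥ s.x)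
    + (-s.mean) • (yIter G τ T (k + 1) - yLim G τ T) with ha
  have h1 : ∀ j, s.dev j = (yIter G τ T (k + 1) (0, j))⁻¹ * a (0, j) := by
    intro j
    have hy := (yIter_pos hτ (k + 1) j).ne'
    rw [eq_inv_mul_iff_mul_eq₀ hy, ha, hJ]
    simp only [State.dev, mul_sub, hz, Pi.add_apply, Pi.sub_apply, Pi.smul_apply, smul_eq_mul]
    ring
  calc norm2 s.dev ≤ yInvSup G τ T * norm2 (fun j => a (0, j)) := by
        refine norm2_le_mul_norm2 (by positivity) fun j => ?_
        rw [h1, abs_mul, abs_of_pos (inv_pos.2 (yIter_pos hτ (k + 1) j))]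
        gcongr
        exact yIter_inv_le_yInvSup hG hτ (k + 1) j
    _ ≤ yInvSup G τ T * norm2 a := by gcongr; exact norm2_actual_le a
    _ ≤ yInvSup G τ T * (c * disagreement G τ N s.x + |s.mean| * yDev G τ T (k + 1)) := by
        gcongr
        refine (norm2_add_le _ _).trans (add_le_add (hN.norm2_le _) ?_)
        rw [norm2_smul, abs_neg]
        rfl
    _ = _ := by ring

/-- The part of the change of the estimates that is due to the `y`-iterates not having converged. -/
noncomputable def yDrift (G : Digraph V) [DecidableRel G.Adj] (τ : V → V → ℕ) (f : V → ℝ → ℝ)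
    (α : ℝ) (x0 z0 : V → ℝ) (k : ℕ) : ℝ :=
  yInvSup G τ T * (α * |(iterate G τ T f α x0 z0 k).meanGrad f| * yDev G τ T (k + 1)
    + (yDev G τ T (k + 1) + yDev G τ T k) * norm2 (iterate G τ T f α x0 z0 k).z)

theorem norm2_z_succ_sub_le (hG : StronglyConnected G) (hτ : DelaysBounded G τ T)
    (hN : IsContractionNorm G τ T N σ c d) (hα : 0 < α) (k : ℕ) :
    norm2 ((iterate G τ T f α x0 z0 (k + 2)).z - (iterate G τ T f α x0 z0 (k + 1)).z)
      ≤ yInvSup G τ T * xi G τ T * c * disagreement G τ N (iterate G τ T f α x0 z0 (k + 1)).x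
        + yInvSup G τ T * c * α * disagreement G τ N (iterate G τ T f α x0 z0 (k + 1)).w
        + α * (√(Fintype.card V) * |(iterate G τ T f α x0 z0 (k + 1)).meanGrad f|)
        + yDrift (T := T) G τ f α x0 z0 (k + 1) := by
  have hZ := one_le_yInvSup hG hτ
  have hξ : 0 ≤ xi G τ T := matNorm2_nonneg _
  have hz := yIter_mul_iterate_z_succ (f := f) (α := α) (x0 := x0) (z0 := z0) hτ k
  have hz' := yIter_mul_iterate_z_succ (f := f) (α := α) (x0 := x0) (z0 := z0) hτ (k + 1)
  have hJ := augLimit_mulVec_x (f := f) (α := α) (x0 := x0) (z0 := z0) hG hτ (k + 1)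
  have hJw := augLimit_mulVec_w (f := f) (α := α) (x0 := x0) (z0 := z0) hG hτ (k + 1)
  have hx := iterate_x_succ (G := G) (τ := τ) (T := T) (f := f) (α := α) (x0 := x0) (z0 := z0)
    (k + 1)
  rw [show k + 1 + 1 = k + 2 from rfl] at hz' hx
  simp only [yDrift, show k + 1 + 1 = k + 2 from rfl]
  set s := iterate G τ T f α x0 z0 (k + 1)
  set s' := iterate G τ T f α x0 z0 (k + 2)
  set y' := yIter G τ T (k + 2)
  set y := yIter G τ T (k + 1)
  set q := s.meanGrad f
  -- `y' (z' - z) = (Ξ - I) x - α w - (y' - y) z`. Here `x` may be replaced by `x - Ξ_∞ x`, and `w`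
  -- is split off from `q * yLim`. Writing `yLim = y' - (y' - yLim)` leaves `-α q` outside the
  -- division by `y'`, so that term gets no factor `ỹ`.
  set a : AugNode V T → ℝ := (augMatrix G τ T - 1) *ᵥ (s.x - augLimit G τ T *ᵥ s.x)
    + (-α) • (s.w - augLimit G τ T *ᵥ s.w) with ha
  set b : V → ℝ := fun j => α * q * (y' (0, j) - yLim G τ T (0, j)) - (y' (0, j) - y (0, j)) * s.z j
    with hb
  have h1 : ∀ j, (s'.z - s.z) j
      = (y' (0, j))⁻¹ * (a (0, j) + b j) + (-(α * q)) := by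
    intro j
    have hy : y' (0, j) ≠ 0 := (yIter_pos hτ (k + 2) j).ne'
    have h2 : a (0, j) = (augMatrix G τ T *ᵥ s.x) (0, j) - s.x (0, j) - α * s.w (0, j)
        + α * q * yLim G τ T (0, j) := by
      rw [ha, mulVec_sub, mulVec_mulVec, sub_mul, one_mul,
        mul_limit_eq (tendsto_augMatrix_pow hG hτ), sub_self, zero_mulVec, sub_zero, sub_mulVec,
        one_mulVec, hJw]
      simp only [Pi.add_apply, Pi.sub_apply, Pi.smul_apply, smul_eq_mul]
      ring
    have h3 : y' (0, j) * s'.z j = (augMatrix G τ T *ᵥ s.x) (0, j) - α * s.w (0, j) := by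
      rw [hz', hx]
      simp
    have h4 : a (0, j) + b j = y' (0, j) * (s'.z j - s.z j + α * q) := by
      rw [h2, hb, ← hz j]
      linear_combination -h3
    rw [h4, inv_mul_cancel_left₀ hy, Pi.sub_apply]
    ring
  have h2 : norm2 (s'.z - s.z)
      ≤ norm2 (fun j => (y' (0, j))⁻¹ * (a (0, j) + b j)) + norm2 (fun _ : V => -(α * q)) := by
    rw [show s'.z - s.z = (fun j => (y' (0, j))⁻¹ * (a (0, j) + b j)) + fun _ : V => -(α * q) from
      funext h1]
    exact norm2_add_le _ _
  have h3 : norm2 (fun j => (y' (0, j))⁻¹ * (a (0, j) + b j))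
      ≤ yInvSup G τ T * (norm2 a + norm2 b) := by
    calc _ ≤ yInvSup G τ T * norm2 ((fun j => a (0, j)) + b) := by
          refine norm2_le_mul_norm2 (by positivity) fun j => ?_
          rw [abs_mul, abs_of_pos (inv_pos.2 (yIter_pos hτ (k + 2) j))]
          exact mul_le_mul_of_nonneg_right (yIter_inv_le_yInvSup hG hτ (k + 2) j) (abs_nonneg _)
      _ ≤ _ := by
          gcongr
          exact (norm2_add_le _ _).trans (add_le_add_left (norm2_actual_le a) _)
  have h4 : norm2 a ≤ xi G τ T * (c * disagreement G τ N s.x) + α * (c * disagreement G τ N s.w) := by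
    refine (norm2_add_le _ _).trans (add_le_add ?_ ?_)
    · refine (norm2_mulVec_le _ _).trans ?_
      exact mul_le_mul_of_nonneg_left (hN.norm2_le _) hξ
    · rw [norm2_smul, abs_neg, abs_of_pos hα]
      exact mul_le_mul_of_nonneg_left (hN.norm2_le _) hα.le
  have h5 : norm2 b ≤ α * |q| * yDev G τ T (k + 2)
      + (yDev G τ T (k + 2) + yDev G τ T (k + 1)) * norm2 s.z := by
    have hb' : b = (fun j => ((α * q) • (y' - yLim G τ T)) (0, j))
        + fun j => -((y' (0, j) - y (0, j)) * s.z j) := by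
      ext j
      simp [hb, sub_eq_add_neg]
    rw [hb']
    refine (norm2_add_le _ _).trans (add_le_add ?_ ?_)
    · refine (norm2_actual_le _).trans ?_
      rw [norm2_smul, abs_mul, abs_of_pos hα]
      rfl
    · have hnn : 0 ≤ yDev G τ T (k + 2) + yDev G τ T (k + 1) :=
        add_nonneg (norm2_nonneg _) (norm2_nonneg _)
      refine norm2_le_mul_norm2 hnn fun j => ?_
      rw [abs_neg, abs_mul]
      gcongr
      have h6 := abs_le_norm2 (y' - yLim G τ T) (0, j)
      have h7 := abs_le_norm2 (y - yLim G τ T) (0, j)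
      calc |y' (0, j) - y (0, j)|
          = |(y' - yLim G τ T) (0, j) - (y - yLim G τ T) (0, j)| := by simp
        _ ≤ |(y' - yLim G τ T) (0, j)| + |(y - yLim G τ T) (0, j)| := abs_sub _ _
        _ ≤ _ := add_le_add h6 h7
  rw [norm2_const, abs_neg, abs_mul, abs_of_pos hα] at h2
  have h6 := mul_le_mul_of_nonneg_left (add_le_add h4 h5) (by positivity : 0 ≤ yInvSup G τ T)
  linarith

end Dynamics

/-! ### The objective gap at the mean. -/

section Gap

variable {V : Type*} [Fintype V] {T : ℕ} {f : V → ℝ → ℝ} {L μ zs : ℝ}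

/-- The scaled gap in the objective at the mean of the `x`-iterate. -/
noncomputable def State.gap (f : V → ℝ → ℝ) (zs : ℝ) (s : State V T) : ℝ :=
  Fintype.card V * (objective f s.mean - objective f zs)

theorem State.card_mul_sq_mean_sub_le [Nonempty V] (hf : LocalAssumptions f L μ)
    (hzs : objectiveGrad f zs = 0) (s : State V T) :
    Fintype.card V * (μ / 2 * (s.mean - zs) ^ 2) ≤ s.gap f zs :=
  mul_le_mul_of_nonneg_left (quadratic_growth hf hzs _) (Nat.cast_nonneg _)

end Gap

/-! ### The error dynamics of the iterates and the rate of convergence. -/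

section Convergence

variable {V : Type*} [Fintype V] [DecidableEq V] [Nontrivial V] {G : Digraph V}
  [DecidableRel G.Adj] {τ : V → V → ℕ} {T : ℕ} {f : V → ℝ → ℝ} {L μ σ c d α zs : ℝ}
  {N : Seminorm ℝ (AugNode V T → ℝ)} {x0 z0 : V → ℝ}

/-- The perturbation of the error dynamics by the `y`-iterates not having converged. -/
noncomputable def perturbation (G : Digraph V) [DecidableRel G.Adj] (τ : V → V → ℕ) (T : ℕ)
    (f : V → ℝ → ℝ) (L α : ℝ) (x0 z0 : V → ℝ) (k : ℕ) : ℝ :=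
  yDrift (T := T) G τ f α x0 z0 k
    + L * (yInvSup G τ T * yDev G τ T k * |(iterate G τ T f α x0 z0 k).mean|)

theorem yDrift_nonneg (hG : StronglyConnected G) (hτ : DelaysBounded G τ T) (hα : 0 < α)
    (k : ℕ) : 0 ≤ yDrift (T := T) G τ f α x0 z0 k := by
  have hZ := one_le_yInvSup hG hτ
  have hy : ∀ k, 0 ≤ yDev G τ T k := fun k => norm2_nonneg _
  have h1 := hy k
  have h2 := hy (k + 1)
  have h3 := norm2_nonneg (iterate G τ T f α x0 z0 k).z
  unfold yDrift
  positivity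

theorem errorStep_iterate (hG : StronglyConnected G) (hτ : DelaysBounded G τ T)
    (hf : LocalAssumptions f L μ) (hzs : objectiveGrad f zs = 0)
    (hN : IsContractionNorm G τ T N σ c d) (hα : 0 < α) (k : ℕ) :
    ErrorStep σ α (1 - α * L + α * μ / 2) (yInvSup G τ T * xi G τ T * c) (yInvSup G τ T * c * α)
      (d * eps G τ T * L) (L * (yInvSup G τ T * c)) (1 / (2 * μ))
      (disagreement G τ N (iterate G τ T f α x0 z0 (k + 1)).x)
      (disagreement G τ N (iterate G τ T f α x0 z0 (k + 1)).w)
      (√(Fintype.card V) * |(iterate G τ T f α x0 z0 (k + 1)).meanGrad f|)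
      ((iterate G τ T f α x0 z0 (k + 1)).gap f zs)
      (perturbation G τ T f L α x0 z0 (k + 1))
      (disagreement G τ N (iterate G τ T f α x0 z0 (k + 2)).x)
      (disagreement G τ N (iterate G τ T f α x0 z0 (k + 2)).w)
      ((iterate G τ T f α x0 z0 (k + 2)).gap f zs) := by
  have hL := hf.L_pos
  have hμ := hf.mu_pos
  have hZ := one_le_yInvSup hG hτ
  have he := eps_pos hG hτ
  have hd := hN.d_pos
  have hc := hN.c_pos
  have hn : (0 : ℝ) < Fintype.card V := by exact_mod_cast Fintype.card_pos
  have hdrift := yDrift_nonneg (f := f) (x0 := x0) (z0 := z0) hG hτ hα (k + 1)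
  have hdev := norm2_dev_succ_le (f := f) (α := α) (x0 := x0) (z0 := z0) hG hτ hN k
  have hzdiff := norm2_z_succ_sub_le (f := f) (x0 := x0) (z0 := z0) hG hτ hN hα k
  have hx := disagreement_x_succ_le (f := f) (x0 := x0) (z0 := z0) hG hτ hN hα (k + 1)
  have hw := disagreement_w_succ_le (α := α) (x0 := x0) (z0 := z0) hG hτ hf hN (k + 1)
  have hmean := iterate_mean_succ (f := f) (α := α) (x0 := x0) (z0 := z0) hτ (k + 1)
  have hydev : 0 ≤ yDev G τ T (k + 1) := norm2_nonneg _
  rw [show k + 1 + 1 = k + 2 from rfl] at hx hw hmean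
  unfold perturbation
  set s := iterate G τ T f α x0 z0 (k + 1)
  set s' := iterate G τ T f α x0 z0 (k + 2)
  set e := disagreement G τ N s.x
  set m := √(Fintype.card V : ℝ) with hm
  have hmm : m ^ 2 = Fintype.card V := Real.sq_sqrt hn.le
  have hm0 : 0 < m := Real.sqrt_pos.2 hn
  have he0 : 0 ≤ e := apply_nonneg N _
  have hr1 : 0 ≤ L * (yInvSup G τ T * yDev G τ T (k + 1) * |s.mean|) := by positivity
  have hinexact : m * |s.meanGrad f - objectiveGrad f s.mean|
      ≤ L * (yInvSup G τ T * c) * e + (yDrift (T := T) G τ f α x0 z0 (k + 1)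
        + L * (yInvSup G τ T * yDev G τ T (k + 1) * |s.mean|)) := by
    have h1 := s.sqrt_card_mul_abs_meanGrad_sub_le hf
    have h2 := mul_le_mul_of_nonneg_left hdev hL.le
    linarith
  refine ⟨he0, apply_nonneg N _, by positivity, ?_, by positivity, apply_nonneg N _,
    apply_nonneg N _, hx, ?_, ?_, ?_⟩
  · exact le_trans (by positivity) (s.card_mul_sq_mean_sub_le hf hzs)
  · refine hw.trans (add_le_add_right (mul_le_mul_of_nonneg_left ?_ (by positivity)) _)
    linarith
  · have h1 := objective_step_le hf hα s.mean (s.meanGrad f)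
    rw [← hmean] at h1
    have h2 : s'.gap f zs ≤ s.gap f zs
        - α * (1 - α * L + α * μ / 2) * (m * |s.meanGrad f|) ^ 2
        + α * (m * |s.meanGrad f|) * (m * |s.meanGrad f - objectiveGrad f s.mean|) := by
      have h3 := mul_le_mul_of_nonneg_left h1 hn.le
      simp only [State.gap, mul_pow, sq_abs, hmm]
      have h4 : α * (m * |s.meanGrad f|) * (m * |s.meanGrad f - objectiveGrad f s.mean|)
          = Fintype.card V * (α * |s.meanGrad f| * |s.meanGrad f - objectiveGrad f s.mean|) := by
        rw [← hmm]; ring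
      rw [h4]
      linarith
    refine h2.trans (add_le_add_right (mul_le_mul_of_nonneg_left ?_ (by positivity)) _)
    linarith
  · have h1 := objective_gap_le hf s.mean zs
    have h2 : m * |objectiveGrad f s.mean|
        ≤ m * |s.meanGrad f| + m * |s.meanGrad f - objectiveGrad f s.mean| := by
      rw [← mul_add]
      gcongr
      have := abs_sub (s.meanGrad f) (s.meanGrad f - objectiveGrad f s.mean)
      rwa [sub_sub_cancel] at this
    calc s.gap f zs ≤ Fintype.card V * (1 / (2 * μ) * objectiveGrad f s.mean ^ 2) :=
          mul_le_mul_of_nonneg_left h1 hn.le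
      _ = 1 / (2 * μ) * (m * |objectiveGrad f s.mean|) ^ 2 := by
          rw [mul_pow, hmm, sq_abs]; ring
      _ ≤ _ := by
          gcongr
          linarith

/-- The perturbation is a geometrically small `y`-error times the sizes of the mean, the estimates
and the mean gradient. All of these are linear in `1 + |mean - zs| + e`, and quadratic growth bounds
`|mean - zs|` by the gap. -/
theorem exists_perturbation_sq_le (hG : StronglyConnected G) (hτ : DelaysBounded G τ T)
    (hf : LocalAssumptions f L μ) (hzs : objectiveGrad f zs = 0)
    (hN : IsContractionNorm G τ T N σ c d) (hα : 0 < α) :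
    ∃ C, 0 ≤ C ∧ ∀ (x0 z0 : V → ℝ) (k : ℕ), perturbation G τ T f L α x0 z0 (k + 1) ^ 2
      ≤ C * σ ^ k * (1 + (iterate G τ T f α x0 z0 (k + 1)).gap f zs
        + disagreement G τ N (iterate G τ T f α x0 z0 (k + 1)).x ^ 2) := by
  obtain ⟨C₀, hC₀, hyC⟩ := exists_yDev_le hG hτ hN
  have hL := hf.L_pos
  have hμ := hf.mu_pos
  have hZ := one_le_yInvSup hG hτ
  have hc := hN.c_pos
  have hσ0 := hN.sigma_nonneg
  have hσ1 := hN.sigma_lt_one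
  have hn : (1 : ℝ) ≤ Fintype.card V := by exact_mod_cast Fintype.card_pos
  have hn0 : (0 : ℝ) < Fintype.card V := by linarith
  obtain ⟨m, hm⟩ : ∃ m, m = √(Fintype.card V : ℝ) := ⟨_, rfl⟩
  have hm1 : 1 ≤ m := by rw [hm]; exact Real.one_le_sqrt.2 hn
  obtain ⟨Z, hZdef⟩ : ∃ Z, Z = yInvSup G τ T := ⟨_, rfl⟩
  rw [← hZdef] at hZ
  obtain ⟨a₁, ha₁⟩ : ∃ a, a = 1 + |zs| := ⟨_, rfl⟩
  obtain ⟨a₂, ha₂⟩ : ∃ a, a = Z * c + Z * C₀ * a₁ := ⟨_, rfl⟩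
  obtain ⟨a₃, ha₃⟩ : ∃ a, a = L * a₂ + L := ⟨_, rfl⟩
  obtain ⟨a₄, ha₄⟩ : ∃ a, a = a₂ + m * a₁ := ⟨_, rfl⟩
  have ha₁0 : 0 ≤ a₁ := by rw [ha₁]; positivity
  have ha₂0 : 0 ≤ a₂ := by rw [ha₂]; positivity
  have ha₃0 : 0 ≤ a₃ := by rw [ha₃]; positivity
  have ha₄0 : 0 ≤ a₄ := by rw [ha₄]; positivity
  obtain ⟨C₁, hC₁⟩ : ∃ C₁, C₁ = Z * (α * a₃ * C₀ + (C₀ + C₀) * a₄) + L * (Z * C₀ * a₁) := ⟨_, rfl⟩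
  have hC₁0 : 0 ≤ C₁ := by rw [hC₁]; positivity
  refine ⟨3 * C₁ ^ 2 * (1 + 2 / (μ * Fintype.card V)), by positivity, fun x0 z0 k => ?_⟩
  have hdev := norm2_dev_succ_le (f := f) (α := α) (x0 := x0) (z0 := z0) hG hτ hN k
  have hrnonneg : 0 ≤ perturbation G τ T f L α x0 z0 (k + 1) := by
    have h1 := yDrift_nonneg (f := f) (x0 := x0) (z0 := z0) hG hτ hα (k + 1)
    have h2 : 0 ≤ yDev G τ T (k + 1) := norm2_nonneg _
    unfold perturbation
    rw [← hZdef]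
    positivity
  have hp2 := (iterate G τ T f α x0 z0 (k + 1)).card_mul_sq_mean_sub_le hf hzs
  have hq := (iterate G τ T f α x0 z0 (k + 1)).sqrt_card_mul_abs_meanGrad_sub_le hf
  have hz := (iterate G τ T f α x0 z0 (k + 1)).norm2_z_le
  have hr : perturbation G τ T f L α x0 z0 (k + 1) = yDrift (T := T) G τ f α x0 z0 (k + 1)
    + L * (Z * yDev G τ T (k + 1) * |(iterate G τ T f α x0 z0 (k + 1)).mean|) := by
    rw [hZdef]; rfl
  rw [yDrift, show k + 1 + 1 = k + 2 from rfl, ← hZdef] at hr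
  rw [← hZdef] at hdev
  rw [← hm] at hq hz
  have hη1 : yDev G τ T (k + 1) ≤ C₀ * σ ^ k :=
    (hyC _).trans (mul_le_mul_of_nonneg_left
      (pow_le_pow_of_le_one hσ0 hσ1.le (by omega)) hC₀)
  have hη2 : yDev G τ T (k + 2) ≤ C₀ * σ ^ k :=
    (hyC _).trans (mul_le_mul_of_nonneg_left
      (pow_le_pow_of_le_one hσ0 hσ1.le (by omega)) hC₀)
  have hη1' : yDev G τ T (k + 1) ≤ C₀ := by
    refine hη1.trans (mul_le_of_le_one_right hC₀ (pow_le_one₀ hσ0 hσ1.le))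
  have hη0 : 0 ≤ yDev G τ T (k + 1) := norm2_nonneg _
  have hη0' : 0 ≤ yDev G τ T (k + 2) := norm2_nonneg _
  set s := iterate G τ T f α x0 z0 (k + 1)
  have he0 : 0 ≤ disagreement G τ N s.x := apply_nonneg N _
  set e := disagreement G τ N s.x
  obtain ⟨p, hp⟩ : ∃ p, p = |s.mean - zs| := ⟨_, rfl⟩
  have hp0 : 0 ≤ p := by rw [hp]; exact abs_nonneg _
  obtain ⟨t, ht⟩ : ∃ t, t = 1 + p + e := ⟨_, rfl⟩
  have ht0 : 0 ≤ t := by rw [ht]; positivity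
  have hpt : p ≤ t := by linarith
  have het : e ≤ t := by linarith
  have ht1 : 1 ≤ t := by linarith
  have hU : |s.mean| ≤ a₁ * t := by
    have h1 : |s.mean| ≤ p + |zs| := by
      have := abs_add_le (s.mean - zs) zs
      rwa [sub_add_cancel, ← hp] at this
    have h2 : |zs| * 1 ≤ |zs| * t := by gcongr
    rw [ha₁]
    linarith
  have hD : norm2 s.dev ≤ a₂ * t := by
    calc norm2 s.dev ≤ Z * c * e + Z * yDev G τ T (k + 1) * |s.mean| := hdev
      _ ≤ Z * c * t + Z * C₀ * (a₁ * t) := by gcongr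
      _ = a₂ * t := by rw [ha₂]; ring
  have hQ : |s.meanGrad f| ≤ a₃ * t := by
    have h1 : |s.meanGrad f - objectiveGrad f s.mean| ≤ L * (a₂ * t) := by
      calc _ ≤ m * |s.meanGrad f - objectiveGrad f s.mean| :=
            le_mul_of_one_le_left (abs_nonneg _) hm1
        _ ≤ L * norm2 s.dev := hq
        _ ≤ L * (a₂ * t) := by gcongr
    have h2 : |objectiveGrad f s.mean| ≤ L * t := by
      have := abs_objectiveGrad_sub_le hf s.mean zs
      rw [hzs, sub_zero, ← hp] at this
      exact this.trans (by gcongr)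
    have h3 := abs_add_le (s.meanGrad f - objectiveGrad f s.mean) (objectiveGrad f s.mean)
    rw [sub_add_cancel] at h3
    rw [ha₃]
    linarith
  have hzt : norm2 s.z ≤ a₄ * t := by
    calc norm2 s.z ≤ a₂ * t + m * (a₁ * t) := hz.trans (by gcongr)
      _ = a₄ * t := by rw [ha₄]; ring
  have hσk : 0 ≤ σ ^ k := by positivity
  have hz0 := norm2_nonneg s.z
  have hrt : perturbation G τ T f L α x0 z0 (k + 1) ≤ C₁ * σ ^ k * t := by
    rw [hr]
    calc _ ≤ Z * (α * (a₃ * t) * (C₀ * σ ^ k) + (C₀ * σ ^ k + C₀ * σ ^ k) * (a₄ * t))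
          + L * (Z * (C₀ * σ ^ k) * (a₁ * t)) := by gcongr
      _ = C₁ * σ ^ k * t := by rw [hC₁]; ring
  have ht2 : t ^ 2 ≤ 3 * (1 + p ^ 2 + e ^ 2) := by
    have h1 := sq_nonneg (1 - p)
    have h2 := sq_nonneg (1 - e)
    have h3 := sq_nonneg (p - e)
    rw [ht]
    linarith
  have hpgap : p ^ 2 ≤ 2 / (μ * Fintype.card V) * s.gap f zs := by
    rw [hp, sq_abs, div_mul_eq_mul_div, le_div_iff₀ (by positivity)]
    linarith
  have hgap0 : 0 ≤ s.gap f zs := le_trans (by positivity) hp2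
  have hσsq : (σ ^ k) ^ 2 ≤ σ ^ k := by
    rw [sq]
    exact mul_le_of_le_one_right hσk (pow_le_one₀ hσ0 hσ1.le)
  have hfin : 1 + p ^ 2 + e ^ 2
      ≤ (1 + 2 / (μ * Fintype.card V)) * (1 + s.gap f zs + e ^ 2) := by
    have h1 : 0 ≤ 2 / (μ * Fintype.card V) * (1 + e ^ 2) := by positivity
    linarith
  calc perturbation G τ T f L α x0 z0 (k + 1) ^ 2 ≤ (C₁ * σ ^ k * t) ^ 2 :=
        pow_le_pow_left₀ hrnonneg hrt 2
    _ = C₁ ^ 2 * (σ ^ k) ^ 2 * t ^ 2 := by ring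
    _ ≤ C₁ ^ 2 * σ ^ k
        * (3 * ((1 + 2 / (μ * Fintype.card V)) * (1 + s.gap f zs + e ^ 2))) := by
        gcongr
        exact ht2.trans (by gcongr)
    _ = _ := by ring

/-- The rate depends on the network, the functions and the step size, but not on the starting
point. -/
theorem exists_rate (hG : StronglyConnected G) (hτ : DelaysBounded G τ T)
    (hf : LocalAssumptions f L μ) (hzs : objectiveGrad f zs = 0)
    (hN : IsContractionNorm G τ T N σ c d) (hα : 0 < α)
    (h : α < alphaBar G τ T L μ σ c d) :
    ∃ ρ : ℝ, 0 < ρ ∧ ρ < 1 ∧ ∀ x0 z0 : V → ℝ, ∃ C : ℝ, ∀ (k : ℕ) (j : V),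
      |(iterate G τ T f α x0 z0 k).z j - zs| ≤ C * ρ ^ k := by
  have hL := hf.L_pos
  have hμ := hf.mu_pos
  have hZ := one_le_yInvSup hG hτ
  have hξ : 0 ≤ xi G τ T := matNorm2_nonneg _
  have he := eps_pos hG hτ
  have hd := hN.d_pos
  have hc := hN.c_pos
  have hσ0 := hN.sigma_nonneg
  have hσ1 := hN.sigma_lt_one
  have hn : (0 : ℝ) < Fintype.card V := by exact_mod_cast Fintype.card_pos
  obtain ⟨hκ, hgain⟩ := small_gain_of_lt_alphaBar hG hτ hμ hf.mu_le_L hN hα h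
  obtain ⟨b, g, η, C₂, hb, hg, hη0, hη1, hC₂, hlyap⟩ :=
    exists_lyapunov (M := 1 / (2 * μ)) hσ0 hσ1 hα hκ (by positivity) (by positivity)
      (by positivity) (by positivity) (by positivity) hgain
  obtain ⟨C₃, hC₃, hpert⟩ := exists_perturbation_sq_le hG hτ hf hzs hN hα
  obtain ⟨C₀, hC₀, hyC⟩ := exists_yDev_le hG hτ hN
  -- Midpoints to `1` keep `ρ` in `(0, 1)` even if `η = 1` or `σ = 0`. Since `W` is quadratic in the
  -- errors, these decay at the rate `√ρ`, fixed before the starting point.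
  obtain ⟨ρ, hρ0, hρ1, hηρ, hσρ⟩ : ∃ ρ : ℝ, 0 < ρ ∧ ρ < 1 ∧ 1 - η < ρ ∧ σ ≤ ρ :=
    ⟨max (1 - η / 2) ((1 + σ) / 2), lt_max_of_lt_left (by linarith),
      max_lt (by linarith) (by linarith), lt_max_of_lt_left (by linarith),
      le_max_of_le_right (by linarith)⟩
  have hρs : √ρ ^ 2 = ρ := Real.sq_sqrt hρ0.le
  have hρs0 : 0 < √ρ := Real.sqrt_pos.2 hρ0
  have hρs1 : √ρ < 1 := by rw [Real.sqrt_lt' one_pos]; simpa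
  refine ⟨√ρ, hρs0, hρs1, fun x0 z0 => ?_⟩
  set s : ℕ → State V T := fun k => iterate G τ T f α x0 z0 (k + 1) with hs
  set W : ℕ → ℝ := fun k => disagreement G τ N (s k).w ^ 2
    + b * disagreement G τ N (s k).x ^ 2 + g * (s k).gap f zs with hW
  have hstep := fun k => errorStep_iterate (x0 := x0) (z0 := z0) hG hτ hf hzs hN hα k
  have hgap0 : ∀ k, 0 ≤ (s k).gap f zs := fun k => (hstep k).gap_nonneg
  have hW0 : ∀ k, 0 ≤ W k := by
    intro k
    have := hgap0 k
    positivity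
  have heW : ∀ k, disagreement G τ N (s k).x ^ 2 ≤ 1 / b * W k := by
    intro k
    rw [one_div_mul_eq_div, le_div_iff₀ hb]
    have := mul_nonneg hg.le (hgap0 k)
    have := sq_nonneg (disagreement G τ N (s k).w)
    simp only [hW]
    linarith
  have hΦW : ∀ k, (s k).gap f zs ≤ 1 / g * W k := by
    intro k
    rw [one_div_mul_eq_div, le_div_iff₀ hg]
    have := mul_nonneg hb.le (sq_nonneg (disagreement G τ N (s k).x))
    have := sq_nonneg (disagreement G τ N (s k).w)
    simp only [hW]
    linarith
  obtain ⟨C', hC', hgeo⟩ := exists_geometric_bound (C := C₂ * (C₃ * (1 + 1 / g + 1 / b)))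
    hη1 hσ0 hρ0 hηρ hσρ hρ1 (by positivity) hW0 (fun k => by
      have h1 := hlyap _ _ _ _ _ _ _ _ (hstep k)
      have h2 : 1 + (s k).gap f zs + disagreement G τ N (s k).x ^ 2
          ≤ (1 + 1 / g + 1 / b) * (1 + W k) := by
        have h3 : 0 ≤ 1 / g + 1 / b := by positivity
        have h4 := heW k
        have h5 := hΦW k
        have h6 := hW0 k
        linarith
      have h7 : C₂ * perturbation G τ T f L α x0 z0 (k + 1) ^ 2
          ≤ C₂ * (C₃ * σ ^ k * ((1 + 1 / g + 1 / b) * (1 + W k))) := by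
        gcongr
        exact (hpert x0 z0 k).trans (by gcongr)
      have h8 : C₂ * (C₃ * σ ^ k * ((1 + 1 / g + 1 / b) * (1 + W k)))
          = C₂ * (C₃ * (1 + 1 / g + 1 / b)) * σ ^ k * (1 + W k) := by ring
      rw [h8] at h7
      exact h1.trans (add_le_add_right h7 _))
  have hroot : ∀ {a M : ℝ} (k : ℕ), 0 ≤ M → a ^ 2 ≤ M * W k → |a| ≤ √(M * C') * √ρ ^ k := by
    intro a M k hM ha
    refine abs_le_of_sq_le_sq ?_ (by positivity)
    rw [mul_pow, Real.sq_sqrt (by positivity), ← pow_mul, mul_comm k, pow_mul, hρs, mul_assoc]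
    exact ha.trans (mul_le_mul_of_nonneg_left (hgeo k) hM)
  obtain ⟨E, hE0, hE⟩ : ∃ E, 0 ≤ E ∧ ∀ k, disagreement G τ N (s k).x ≤ E * √ρ ^ k :=
    ⟨√(1 / b * C'), Real.sqrt_nonneg _, fun k =>
      (le_abs_self _).trans (hroot k (by positivity) (heW k))⟩
  obtain ⟨P, hP0, hP⟩ : ∃ P, 0 ≤ P ∧ ∀ k, |(s k).mean - zs| ≤ P * √ρ ^ k := by
    refine ⟨√(2 / (μ * Fintype.card V) * (1 / g) * C'), Real.sqrt_nonneg _, fun k =>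
      hroot k (by positivity) ?_⟩
    have h1 := (s k).card_mul_sq_mean_sub_le hf hzs
    have h2 := hΦW k
    rw [mul_assoc, div_mul_eq_mul_div, le_div_iff₀ (by positivity)]
    linarith
  set K := yInvSup G τ T * c * E + yInvSup G τ T * C₀ * (P + |zs|) + P with hK
  have hK0 : 0 ≤ K := by positivity
  have hmain : ∀ k j, |(s k).z j - zs| ≤ K * √ρ ^ k := by
    intro k j
    have hρk1 : √ρ ^ k ≤ 1 := pow_le_one₀ hρs0.le hρs1.le
    have hσρ' : σ ≤ √ρ := hσρ.trans (Real.le_sqrt_of_sq_le (by nlinarith))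
    have hy : yDev G τ T (k + 1) ≤ C₀ * √ρ ^ k := by
      calc yDev G τ T (k + 1) ≤ C₀ * σ ^ (k + 1) := hyC _
        _ ≤ C₀ * σ ^ k :=
          mul_le_mul_of_nonneg_left (pow_le_pow_of_le_one hσ0 hσ1.le (by omega)) hC₀
        _ ≤ C₀ * √ρ ^ k := by gcongr
    have hmean : |(s k).mean| ≤ P + |zs| := by
      have h1 := abs_add_le ((s k).mean - zs) zs
      rw [sub_add_cancel] at h1
      have h2 := (hP k).trans (mul_le_of_le_one_right hP0 hρk1)
      linarith
    have hdev : norm2 (s k).dev ≤ yInvSup G τ T * c * (E * √ρ ^ k)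
        + yInvSup G τ T * (C₀ * √ρ ^ k) * (P + |zs|) := by
      refine (norm2_dev_succ_le (f := f) (α := α) (x0 := x0) (z0 := z0) hG hτ hN k).trans ?_
      have := hE k
      gcongr
    have h1 : (s k).z j - zs = (s k).dev j + ((s k).mean - zs) := by
      simp [State.dev]
    rw [h1]
    have h2 := abs_add_le ((s k).dev j) ((s k).mean - zs)
    have h3 := abs_le_norm2 (s k).dev j
    have h4 := hP k
    rw [hK]
    linarith
  -- Dividing by `√ρ` undoes the index shift in `s`; the sum accounts for the arbitrary `z0` at `k =
  -- 0`.
  refine ⟨K / √ρ + ∑ j, |z0 j - zs|, fun k j => ?_⟩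
  have hS : 0 ≤ ∑ j, |z0 j - zs| := Finset.sum_nonneg fun j _ => abs_nonneg _
  cases k with
  | zero =>
    have h1 : |z0 j - zs| ≤ ∑ j, |z0 j - zs| :=
      Finset.single_le_sum (f := fun j => |z0 j - zs|) (fun j _ => abs_nonneg _)
        (Finset.mem_univ j)
    have h2 : 0 ≤ K / √ρ := by positivity
    rw [pow_zero, mul_one]
    exact h1.trans (le_add_of_nonneg_left h2)
  | succ k =>
    refine (hmain k j).trans ?_
    rw [pow_succ', add_mul (K / √ρ)]
    have h1 : K / √ρ * (√ρ * √ρ ^ k) = K * √ρ ^ k := by field_simp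
    rw [h1]
    exact le_add_of_nonneg_right (by positivity)

end Convergence

end RAddOpt

theorem mainTheorem1 {V : Type*} [Fintype V] [DecidableEq V] [Nontrivial V]
    (G : Digraph V) [DecidableRel G.Adj] (hG : RAddOpt.StronglyConnected G)
    (τ : V → V → ℕ) (T : ℕ) (hτ : RAddOpt.DelaysBounded G τ T)
    (f : V → ℝ → ℝ) (L μ : ℝ) (hf : RAddOpt.LocalAssumptions f L μ) :
    -- the limit of the powers of `Ξ` exists
    Tendsto (fun k : ℕ => RAddOpt.augMatrix G τ T ^ k) atTop (𝓝 (RAddOpt.augLimit G τ T)) ∧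
    -- the suprema in the step-size bound are finite, and no division by zero occurs
    BddAbove (Set.range fun k : ℕ =>
      RAddOpt.matNorm2 (Matrix.diagonal (RAddOpt.yIter G τ T k))) ∧
    BddAbove (Set.range fun k : ℕ =>
      RAddOpt.matNorm2 (Matrix.diagonal fun j : V => (RAddOpt.yIter G τ T k (0, j))⁻¹)) ∧
    (∀ (k : ℕ) (j : V), 0 < RAddOpt.yIter G τ T k (0, j)) ∧
    -- a norm in which `Ξ` contracts towards its limit exists
    (∃ (N : Seminorm ℝ (RAddOpt.AugNode V T → ℝ)) (σ c d : ℝ),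
      RAddOpt.IsContractionNorm G τ T N σ c d) ∧
    -- the problem has a unique solution, to which the algorithm converges exponentially
    ∃ zstar : ℝ,
      (∀ z : ℝ, z ≠ zstar → RAddOpt.objective f zstar < RAddOpt.objective f z) ∧
      ∀ (N : Seminorm ℝ (RAddOpt.AugNode V T → ℝ)) (σ c d : ℝ),
        RAddOpt.IsContractionNorm G τ T N σ c d →
          0 < RAddOpt.alphaBar G τ T L μ σ c d ∧
          ∀ α : ℝ, 0 < α → α < RAddOpt.alphaBar G τ T L μ σ c d →
            ∃ ρ : ℝ, 0 < ρ ∧ ρ < 1 ∧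
              ∀ x0 z0 : V → ℝ, ∃ C : ℝ, ∀ (k : ℕ) (j : V),
                |(RAddOpt.iterate G τ T f α x0 z0 k).z j - zstar| ≤ C * ρ ^ k := by

  have hμ := hf.mu_pos
  obtain ⟨zs, hzs⟩ := RAddOpt.exists_objectiveGrad_eq_zero hf
  refine ⟨RAddOpt.tendsto_augMatrix_pow hG hτ, RAddOpt.bddAbove_yIter hG hτ,
    RAddOpt.bddAbove_yIter_inv hG hτ, RAddOpt.yIter_pos hτ,
    RAddOpt.exists_isContractionNorm hG hτ, zs, fun z hz => ?_, fun N σ c d hN =>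
    ⟨RAddOpt.alphaBar_pos hG hτ hf.L_pos hμ hN, fun α hα h =>
      RAddOpt.exists_rate hG hτ hf hzs hN hα h⟩⟩
  have h1 := RAddOpt.quadratic_growth hf hzs z
  have h2 : 0 < μ / 2 * (z - zs) ^ 2 := mul_pos (half_pos hμ) (sq_pos_of_ne_zero (sub_ne_zero.2 hz))
  linarith
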